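/- Let $p$ be a prime, $m\ge 1$, $q=p^m$, and let $\gamma$ be a generator of $\mathbb F_{q^2}^*$. Let $h,\Delta$ be positive integers with $h\not\equiv 0\pmod{q+1}$ and $\gcd(\Delta,q-1)=1$, and put $e=\gcd(h,q+1)$. Let $\mathrm{Tr}_q,\mathrm{Tr}_{q^2}$ be the trace maps from $\mathbb F_q,\mathbb F_{q^2}$ to $\mathbb F_p$. Put $B_j=q^{-1}(q-1)^j+(-1)^j(1-q^{-1})$, $N_0=1$, $N_1=0$ and, for $r\ge 2$, $$N_r=r!\,e^r\sum_{\substack{\lambda_2,\lambda_3,\ldots\ge 0\\ \sum_{j\ge2} j\lambda_j=r}}\binom{\frac{q+1}{e}}{\sum_j\lambda_j}\Bigl(\sum_j\lambda_j\Bigr)!\prod_{j}\frac{(B_j/j!)^{\lambda_j}}{\lambda_j!}.$$ For $n\ge 1$ let $M_n=\bigl[(jeq-q-1)^i\bigr]_{0\le i,j\le n-1}$. (i) Let $p=2$, let $0\le t\le\frac{q+1}{2e}$, and let $d_0,\ldots,d_t$ be integers with $d_j\equiv s_j(q-1)+\Delta\pmod{q^2-1}$, where $s_j\equiv jh+\frac{\Delta}{2}\pmod{q+1}$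 (division by $2$ modulo the odd number $q+1$). Let $\mathcal C^{(1)}$ be the set of all words $\bigl(\mathrm{Tr}_q(a_0\gamma^{d_0i})+\mathrm{Tr}_{q^2}(\sum_{j=1}^t a_j\gamma^{d_ji})\bigr)_{i=0}^{q^2-2}$ with $a_0\in\mathbb F_q$ and $a_1,\ldots,a_t\in\mathbb F_{q^2}$. For $0\le j\le 2t$ let $\mu_j$ be the number of words of Hamming weight $w_j=\frac{q^2-(je-1)q}{2}$ in $\mathcal C^{(1)}$, let $\mu=(\mu_0,\ldots,\mu_{2t})^T$ and $b=(b_0,\ldots,b_{2t})^T$ with $b_i=q^{2t+1}N_i-(q^2-1)^i$. Then $M_{2t+1}$ is invertible and $\mu=M_{2t+1}^{-1}b$. Moreover, for $0\le r\le 2t+1$, $N_r$ is the number of $(x_1,\ldots,x_r)\in(\mathbb F_{q^2}^*)^r$ with $x_1^{d_j}+\cdots+x_r^{d_j}=0$ for all $0\le j\le t$. (ii) Let $p$ be any prime, let $1\le t\le\frac{q+1}{2e}$, assume that $h$ is odd if $p$ is odd, and let $\tilde d_1,\ldots,\tilde d_t$ be integers with $\tilde d_j\equiv\tilde s_j(q-1)+\Delta\pmod{q^2-1}$,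 where $\tilde s_j\equiv jh+\frac{\Delta-h}{2}\pmod{q+1}$ (for $p=2$ division by $2$ is modulo $q+1$; for odd $p$, $\Delta-h$ is even and $\frac{\Delta-h}{2}$ is an integer). Let $\mathcal C^{(2)}$ be the set of all words $\bigl(\mathrm{Tr}_{q^2}(\sum_{j=1}^t a_j\gamma^{\tilde d_ji})\bigr)_{i=0}^{q^2-2}$ with $a_1,\ldots,a_t\in\mathbb F_{q^2}$. For $0\le j\le 2t-1$ let $\tilde\mu_j$ be the number of words of Hamming weight $\tilde w_j=\frac{p-1}{p}\bigl(q^2-(je-1)q\bigr)$ in $\mathcal C^{(2)}$, let $\tilde\mu=(\tilde\mu_0,\ldots,\tilde\mu_{2t-1})^T$ and $\tilde b=(\tilde b_0,\ldots,\tilde b_{2t-1})^T$ with $\tilde b_i=q^{2t}N_i-(q^2-1)^i$. Then $M_{2t}$ is invertible and $\tilde\mu=M_{2t}^{-1}\tilde b$. Moreover, for $0\le r\le 2t$, $N_r$ is the number of $(x_1,\ldots,x_r)\in(\mathbb F_{q^2}^*)^r$ with $x_1^{\tilde d_j}+\cdots+x_r^{\tilde d_j}=0$ for all $1\le j\le t$.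 -/

import Mathlib

/-- The set `{(c_i)_{i=0}^{q^2-2}}` of words
`c_i = Tr_q (a_0 γ ^ (d_0 i)) + Tr_{q^2} (∑_{j=1}^t a_j γ ^ (d_j i))` over `𝔽_p`, where `a_0` runs
through `L = 𝔽_q`, the `a_j` with `1 ≤ j ≤ t` run through `K = 𝔽_{q^2}`, and `Tr_q`, `Tr_{q^2}` are
the traces to `𝔽_p`.  The element `y` of `L` is the product `a_0 γ ^ (d_0 i)`; it exists for every
`a_0` and `i` as soon as `q + 1` divides `d_0`, which the choice of the exponents guarantees. -/
def nihoCodeOne (p q : ℕ) (L K : Type*) [Field L] [Field K] [Algebra L K]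
    [Algebra (ZMod p) L] [Algebra (ZMod p) K] (γ : Kˣ) {t : ℕ} (d : Fin (t + 1) → ℤ) :
    Set (Fin (q ^ 2 - 1) → ZMod p) :=
  {c | ∃ (a₀ : L) (a : Fin t → K), ∀ i : Fin (q ^ 2 - 1),
    ∃ y : L, algebraMap L K y = algebraMap L K a₀ * ((γ ^ (d 0 * (i : ℤ)) : Kˣ) : K) ∧
      c i = Algebra.trace (ZMod p) L y +
        Algebra.trace (ZMod p) K (∑ j : Fin t, a j * ((γ ^ (d j.succ * (i : ℤ)) : Kˣ) : K))}

/-- The set of words `c_i = Tr_{q^2} (∑_{j=1}^t a_j γ ^ (d_j i))`, `0 ≤ i ≤ q^2 - 2`, over `𝔽_p`,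
where the `a_j` run through `K = 𝔽_{q^2}`.  The exponents `d_1, …, d_t` are `d 0, …, d (t - 1)`. -/
def nihoCodeTwo (p q : ℕ) (K : Type*) [Field K] [Algebra (ZMod p) K] (γ : Kˣ) {t : ℕ}
    (d : Fin t → ℤ) : Set (Fin (q ^ 2 - 1) → ZMod p) :=
  {c | ∃ a : Fin t → K, ∀ i : Fin (q ^ 2 - 1),
    c i = Algebra.trace (ZMod p) K (∑ j : Fin t, a j * ((γ ^ (d j * (i : ℤ)) : Kˣ) : K))}

/-- `u` is "`n / 2` modulo `q + 1`": for `p = 2` (so `q + 1` is odd) division by `2` takes place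
modulo `q + 1`, for odd `p` it takes place in `ℤ`. -/
def IsHalf (p q : ℕ) (n u : ℤ) : Prop :=
  if p = 2 then 2 * u ≡ n [ZMOD (q : ℤ) + 1] else 2 * u = n

/-- `d_j ≡ s_j (q - 1) + Δ (mod q^2 - 1)` with `s_j ≡ j h + Δ / 2 (mod q + 1)`, `0 ≤ j ≤ t`. -/
def IsExponentsOne (p q h Δ : ℕ) {t : ℕ} (d : Fin (t + 1) → ℤ) : Prop :=
  ∀ j : Fin (t + 1), ∃ s u : ℤ, IsHalf p q (Δ : ℤ) u ∧
    s ≡ (j : ℕ) * (h : ℤ) + u [ZMOD (q : ℤ) + 1] ∧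
    d j ≡ s * ((q : ℤ) - 1) + Δ [ZMOD (q : ℤ) ^ 2 - 1]

/-- `d_j ≡ s_j (q - 1) + Δ (mod q^2 - 1)` with `s_j ≡ j h + (Δ - h) / 2 (mod q + 1)`, `1 ≤ j ≤ t`
(`d_j` is `d (j - 1)` here). -/
def IsExponentsTwo (p q h Δ : ℕ) {t : ℕ} (d : Fin t → ℤ) : Prop :=
  ∀ j : Fin t, ∃ s u : ℤ, IsHalf p q ((Δ : ℤ) - h) u ∧
    s ≡ ((j : ℕ) + 1) * (h : ℤ) + u [ZMOD (q : ℤ) + 1] ∧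
    d j ≡ s * ((q : ℤ) - 1) + Δ [ZMOD (q : ℤ) ^ 2 - 1]

/-- The number of words of Hamming weight `w` in the code `C`. -/
noncomputable def weightFrequency {p n : ℕ} (C : Set (Fin n → ZMod p)) (w : ℚ) : ℕ :=
  {c | c ∈ C ∧ (hammingNorm c : ℚ) = w}.ncard

/-- `B_j = q⁻¹ (q - 1) ^ j + (-1) ^ j (1 - q⁻¹)`. -/
def powerSumB (q j : ℕ) : ℚ :=
  (q : ℚ)⁻¹ * ((q : ℚ) - 1) ^ j + (-1) ^ j * (1 - (q : ℚ)⁻¹)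

open scoped Nat in
/-- `N_0 = 1`, `N_1 = 0`, and for `r ≥ 2`
`N_r = r! e^r ∑ binom((q+1)/e, ∑ λ_j) (∑ λ_j)! ∏ (B_j / j!) ^ λ_j / λ_j!`, summed over all
`λ_2, λ_3, … ≥ 0` with `∑ j λ_j = r`; that condition forces `λ_j = 0` for `j > r` and `λ_j ≤ r`. -/
def powerSumN (q e : ℕ) : ℕ → ℚ
  | 0 => 1
  | 1 => 0
  | r@(_ + 2) =>
    (r ! : ℚ) * (e : ℚ) ^ r *
      ∑ l ∈ (Fintype.piFinset fun _ : Finset.Icc 2 r => Finset.range (r + 1)) with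
          ∑ j : Finset.Icc 2 r, (j : ℕ) * l j = r,
        (Nat.choose ((q + 1) / e) (∑ j, l j) : ℚ) * ((∑ j, l j)! : ℚ) *
          ∏ j : Finset.Icc 2 r, (powerSumB q j / ((j : ℕ)! : ℚ)) ^ l j / ((l j)! : ℚ)

/-- The `n × n` matrix with entries `(j e q - q - 1) ^ i`, `0 ≤ i, j ≤ n - 1`. -/
def momentMatrix (q e n : ℕ) : Matrix (Fin n) (Fin n) ℚ :=
  Matrix.of fun i j => (((j : ℕ) : ℚ) * e * q - q - 1) ^ (i : ℕ)

/-- The vector with entries `q ^ n N_i - (q^2 - 1) ^ i`, `0 ≤ i ≤ n - 1`. -/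
def momentVector (q e n : ℕ) : Fin n → ℚ :=
  fun i => (q : ℚ) ^ n * powerSumN q e i - ((q : ℚ) ^ 2 - 1) ^ (i : ℕ)

/-- The number of `(x_1, …, x_r) ∈ (K^*)^r` with `x_1 ^ d_j + ⋯ + x_r ^ d_j = 0` for all `j`. -/
noncomputable def powerSumCount (K : Type*) [Field K] {n : ℕ} (d : Fin n → ℤ) (r : ℕ) : ℕ :=
  {x : Fin r → Kˣ | ∀ j, ∑ k, ((x k ^ d j : Kˣ) : K) = 0}.ncard

/-! All exponents have the form `d_j ≡ D + j h (q - 1)` modulo `q ^ 2 - 1`, with `D ≡ Δ` modulo `q -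
1`. Let `W` be the group of the elements `v(x) = x ^ ((q - 1) h)`; it has order `(q + 1) / e`. If `κ
^ ((q - 1) h) = 1`, then all `κ ^ (d_j)` equal `κ ^ D`, which lies in `𝔽_q`. Hence the `𝔽_q`-linear
functional `f x` whose trace to `𝔽_p` is the letter of a word at `x` is a scalar multiple `c(x) • g
(v x)` of a functional depending only on `v(x)`. Since `gcd(Δ, q - 1) = 1`, every pair in `W ×
𝔽_q^*` arises from exactly `e` elements `x`.

Any `n` of the `g w` are independent, where `n` is the dimension `2t + 1` or `2t` of the coefficient
space. Indeed, a relation among them kills the power sums with exponents `d_j` and, by Frobenius,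
those with exponents `q d_j`. Together these are `D + i h (q - 1)` for `n` consecutive `i`, so a
Vandermonde argument applies (`eq_zero_of_sum_mul_zpow_eq_zero`). The structure `IsScaledFamily`
records these facts, and the rest follows from it alone.

A nonzero coefficient vector `a` is killed by `z < n` of the `g w`, and its word has weight `(p - 1)
/ p * q * (q + 1 - e z)`. For a nontrivial additive character `ψ` of `𝔽_q`, the sum of `ψ (f x a)`
over `x` is `z e q - q - 1`. Summing its `r`-th power over all `a` gives `q ^ n` times the number of
`r`-tuples with `∑ f (x_k) = 0`. The vector `a = 0` contributes `(q ^ 2 - 1) ^ r`, so these moments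
form a Vandermonde system for the frequencies.

For `r ≤ n`, independence turns `∑ f (x_k) = 0` into the vanishing of the scalar sum over each fibre
of `k ↦ v(x_k)`. A fibre of size `j` allows `B_j` choices of scalars, and the exponential generating
function of the `B_j` to the power `(q + 1) / e` yields `N_r`. -/

/-! ### Generating function behind `N_r`. -/

open scoped Nat in
/-- A sum over functions `Fin r → W` that depends only on the sizes of the fibres, as a coefficient
of a power of the exponential generating function. -/
theorem sum_prod_card_fiber_eq_coeff {W : Type*} [Fintype W] [DecidableEq W] (B : ℕ → ℚ) (r : ℕ) :
    ∑ f : Fin r → W, ∏ w, B (Finset.card {k | f k = w}) =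
      (r ! : ℚ) * ((∑ j ∈ Finset.range (r + 1),
        Polynomial.C (B j / (j ! : ℚ)) * Polynomial.X ^ j) ^ Fintype.card W).coeff r := by
  -- Umbral evaluation: `E` replaces each monomial by the product of the `B` of its exponents.
  -- Applied to the `r`-th power of the sum of the variables, expanded in two ways, it groups the
  -- functions by their fibre sizes.
  let E : MvPolynomial W ℚ →ₗ[ℚ] ℚ :=
    (MvPolynomial.basisMonomials W ℚ).constr ℚ fun m => ∏ w, B (m w)
  have hE : ∀ k : W → ℕ, E (∏ w, MvPolynomial.X w ^ k w) = ∏ w, B (k w) := fun k => by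
    have : (∏ w, MvPolynomial.X w ^ k w : MvPolynomial W ℚ) =
        MvPolynomial.basisMonomials W ℚ (Finsupp.equivFunOnFinite.symm k) := by
      rw [MvPolynomial.coe_basisMonomials]
      beta_reduce
      rw [MvPolynomial.monomial_eq, map_one, one_mul,
        Finsupp.prod_fintype _ _ (fun _ => pow_zero _)]
      simp
    rw [this, Module.Basis.constr_basis]
    simp
  have h1 := congrArg E (Fintype.sum_pow (fun w : W => (MvPolynomial.X w : MvPolynomial W ℚ)) r)
  rw [Finset.sum_pow_eq_sum_piAntidiag, map_sum, map_sum] at h1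
  have h2 : ∀ f : Fin r → W, (∏ i, MvPolynomial.X (f i) : MvPolynomial W ℚ) =
      ∏ w, MvPolynomial.X w ^ (Finset.card {k | f k = w}) := fun f => by
    rw [← Finset.prod_fiberwise Finset.univ f]
    refine Finset.prod_congr rfl fun w _ => Finset.prod_eq_pow_card fun i hi => ?_
    rw [(Finset.mem_filter.1 hi).2]
  simp only [h2, hE] at h1
  rw [← h1, ← Finset.card_univ, ← Finset.prod_const, Finset.prod_univ_sum,
    Polynomial.finsetSum_coeff, Finset.mul_sum]
  simp only [Finset.prod_mul_distrib, Finset.prod_pow_eq_pow_sum, ← map_prod,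
    Polynomial.coeff_C_mul, Polynomial.coeff_X_pow, mul_ite, mul_one, mul_zero]
  rw [← Finset.sum_filter]
  refine Finset.sum_congr ?_ fun k hk => ?_
  · ext k
    simp only [Finset.mem_piAntidiag, Finset.mem_univ, implies_true, and_true, Finset.mem_filter,
      Fintype.mem_piFinset, Finset.mem_range]
    refine ⟨fun hk => ⟨fun w => ?_, hk.symm⟩, fun hk => hk.2.symm⟩
    have := Finset.single_le_sum (f := k) (fun _ _ => Nat.zero_le _) (Finset.mem_univ w)
    exact Nat.lt_succ_of_le (this.trans hk.le)
  · have hs : Finset.univ.sum k = r := (Finset.mem_filter.1 hk).2.symm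
    have := Nat.multinomial_spec Finset.univ k
    rw [hs] at this
    rw [← nsmul_eq_mul, map_nsmul, hE, nsmul_eq_mul, ← this, Finset.prod_div_distrib]
    push_cast
    have h0 : (∏ w, ((k w)! : ℚ)) ≠ 0 :=
      Finset.prod_ne_zero_iff.2 fun w _ => by exact_mod_cast (k w).factorial_ne_zero
    field_simp

open scoped Nat in
/-- The `r`-th coefficient of `(1 + ∑_{2 ≤ j ≤ r} c_j X ^ j) ^ N`. -/
theorem coeff_one_add_sum_pow (c : ℕ → ℚ) (r N : ℕ) :
    ((1 + ∑ j : Finset.Icc 2 r, Polynomial.C (c j) * Polynomial.X ^ (j : ℕ)) ^ N).coeff r =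
      ∑ l ∈ (Fintype.piFinset fun _ : Finset.Icc 2 r => Finset.range (r + 1)) with
          ∑ j : Finset.Icc 2 r, (j : ℕ) * l j = r,
        (N.choose (∑ j, l j) : ℚ) * ((∑ j, l j)! : ℚ) *
          ∏ j : Finset.Icc 2 r, c j ^ l j / ((l j)! : ℚ) := by
  rw [add_comm, add_pow, Polynomial.finsetSum_coeff]
  have h1 : ∀ k : ℕ, (((∑ j : Finset.Icc 2 r, Polynomial.C (c j) * Polynomial.X ^ (j : ℕ)) ^ k *
      1 ^ (N - k) * (N.choose k : Polynomial ℚ)).coeff r) =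
      ∑ l ∈ ({l ∈ (Fintype.piFinset fun _ : Finset.Icc 2 r => Finset.range (r + 1)) |
          ∑ j : Finset.Icc 2 r, (j : ℕ) * l j = r} : Finset _) with ∑ j, l j = k,
        (N.choose (∑ j, l j) : ℚ) * ((∑ j, l j)! : ℚ) *
          ∏ j : Finset.Icc 2 r, c j ^ l j / ((l j)! : ℚ) := fun k => by
    rw [one_pow, mul_one, Finset.sum_pow_eq_sum_piAntidiag, Finset.sum_mul,
      Polynomial.finsetSum_coeff]
    simp only [mul_pow, Finset.prod_mul_distrib, ← pow_mul, Finset.prod_pow_eq_pow_sum,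
      ← Polynomial.C_pow, ← map_prod, ← Polynomial.C_eq_natCast]
    have h2 : ∀ (a b d : ℚ) (n : ℕ), (Polynomial.C a * (Polynomial.C b * Polynomial.X ^ n) *
        Polynomial.C d).coeff r = if n = r then a * b * d else 0 := fun a b d n => by
      rw [Polynomial.coeff_mul_C, Polynomial.coeff_C_mul, Polynomial.coeff_C_mul,
        Polynomial.coeff_X_pow]
      split_ifs with h h' h'
      · ring
      · exact absurd h.symm h'
      · exact absurd h'.symm h
      · ring
    simp only [Polynomial.C_eq_natCast] at h2 ⊢
    simp only [← Polynomial.C_eq_natCast, h2]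
    rw [← Finset.sum_filter]
    refine Finset.sum_congr ?_ fun l hl => ?_
    · ext l
      simp only [Finset.mem_filter, Finset.mem_piAntidiag, Finset.mem_univ, implies_true, and_true,
        Fintype.mem_piFinset, Finset.mem_range]
      refine ⟨fun h => ⟨⟨fun j => ?_, h.2⟩, h.1⟩, fun h => ⟨h.2, h.1.2⟩⟩
      have h3 := Finset.single_le_sum (f := fun j : Finset.Icc 2 r => (j : ℕ) * l j)
        (fun _ _ => Nat.zero_le _) (Finset.mem_univ j)
      have h4 : 2 ≤ (j : ℕ) := (Finset.mem_Icc.1 j.2).1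
      have h5 : l j ≤ j * l j := Nat.le_mul_of_pos_left _ (by omega)
      simp only [h.2] at h3
      omega
    · have hs : ∑ j, l j = k := (Finset.mem_filter.1 hl).2
      have h3 := Nat.multinomial_spec Finset.univ l
      rw [hs] at h3
      have h0 : (∏ w, ((l w)! : ℚ)) ≠ 0 :=
        Finset.prod_ne_zero_iff.2 fun w _ => by exact_mod_cast (l w).factorial_ne_zero
      rw [hs, ← h3, Finset.prod_div_distrib]
      push_cast
      field_simp
  simp only [h1]
  rw [Finset.sum_fiberwise_eq_sum_filter]
  refine Finset.sum_filter_of_ne fun l _ hl => ?_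
  rw [Finset.mem_range]
  -- Index vectors with `∑ l_j > N` lie outside the range of the binomial expansion, but their
  -- binomial coefficient is `0`.
  by_contra hlt
  exact hl (by rw [Nat.choose_eq_zero_of_lt (by omega)]; simp)

theorem powerSumB_zero {q : ℕ} : powerSumB q 0 = 1 := by
  simp [powerSumB]

theorem powerSumB_one {q : ℕ} (hq : q ≠ 0) : powerSumB q 1 = 0 := by
  have : (q : ℚ) ≠ 0 := by exact_mod_cast hq
  simp only [powerSumB]
  field_simp
  ring

/-- `powerSumN` as a sum over functions to a set with `(q + 1) / e` elements. -/
theorem powerSumN_eq_sum_prod_card_fiber {W : Type*} [Fintype W] [DecidableEq W] {q e : ℕ}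
    (hq : q ≠ 0) (hW : Fintype.card W = (q + 1) / e) (r : ℕ) :
    powerSumN q e r =
      (e : ℚ) ^ r * ∑ f : Fin r → W, ∏ w, powerSumB q (Finset.card {k | f k = w}) := by
  match r with
  | 0 => simp [powerSumN, powerSumB_zero]
  | 1 =>
    rw [sum_prod_card_fiber_eq_coeff]
    simp [powerSumN, Finset.sum_range_succ, powerSumB_zero, powerSumB_one hq,
      Polynomial.coeff_one]
  | r + 2 =>
    have h1 : (∑ j ∈ Finset.range (r + 2 + 1), Polynomial.C (powerSumB q j / (j.factorial : ℚ)) *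
        Polynomial.X ^ j) = 1 + ∑ j : Finset.Icc 2 (r + 2),
          Polynomial.C (powerSumB q j / ((j : ℕ).factorial : ℚ)) * Polynomial.X ^ (j : ℕ) := by
      rw [Finset.sum_coe_sort (Finset.Icc 2 (r + 2)) fun j : ℕ =>
          Polynomial.C (powerSumB q j / (j.factorial : ℚ)) * Polynomial.X ^ j,
        show Finset.Icc 2 (r + 2) = Finset.Ico 2 (r + 2 + 1) from rfl, Finset.range_eq_Ico,
        Finset.sum_eq_sum_Ico_succ_bot (by omega), Finset.sum_eq_sum_Ico_succ_bot (by omega)]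
      simp [powerSumB_zero, powerSumB_one hq]
    rw [sum_prod_card_fiber_eq_coeff, h1, hW,
      coeff_one_add_sum_pow (fun j => powerSumB q j / (j.factorial : ℚ))]
    rw [← mul_assoc, mul_comm ((e : ℚ) ^ (r + 2))]
    rfl

/-! ### Character sums over units. -/

/-- A sum over the units of a field. -/
theorem sum_units_eq_sum_sub {L M : Type*} [Field L] [Fintype L] [DecidableEq L] [AddCommGroup M]
    (F : L → M) : ∑ l : Lˣ, F l = ∑ x, F x - F 0 := by
  rw [← Finset.sum_erase_eq_sub (Finset.mem_univ 0)]
  refine Finset.sum_bij (fun l _ => (l : L)) (fun l _ => by simp)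
    (fun _ _ _ _ h => Units.ext h) (fun b hb => ?_) (fun _ _ => rfl)
  exact ⟨Units.mk0 b (Finset.ne_of_mem_erase hb), Finset.mem_univ _, rfl⟩

theorem AddChar.IsPrimitive.sum_units_mul {L : Type*} [Field L] [Fintype L] [DecidableEq L]
    {ψ : AddChar L ℂ} (hψ : ψ.IsPrimitive) (y : L) :
    ∑ l : Lˣ, ψ (l * y) = (if y = 0 then (Fintype.card L : ℂ) else 0) - 1 := by
  rw [sum_units_eq_sum_sub fun x => ψ (x * y), AddChar.sum_mulShift y hψ, zero_mul,
    AddChar.map_zero_eq_one]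
  split_ifs <;> simp

theorem AddChar.map_finset_sum {ι L : Type*} [AddCommMonoid L] (ψ : AddChar L ℂ) (s : Finset ι)
    (u : ι → L) : ψ (∑ i ∈ s, u i) = ∏ i ∈ s, ψ (u i) := by
  classical
  induction s using Finset.induction_on with
  | empty => simp
  | insert i s hi ih => rw [Finset.sum_insert hi, Finset.prod_insert hi, AddChar.map_add_eq_mul, ih]

open Classical in
/-- The number of families of units of a finite field whose sum over each fibre of `f`
vanishes. -/
theorem card_units_sum_fiber_eq_zero {L W ι : Type*} [Field L] [Fintype L] [Fintype W] [Fintype ι]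
    (f : ι → W) :
    ((Finset.card {l : ι → Lˣ | ∀ w, ∑ k with f k = w, (l k : L) = 0} : ℕ) : ℚ) =
      ∏ w, powerSumB (Fintype.card L) (Finset.card {k | f k = w}) := by
  have hq : (Fintype.card L : ℂ) ≠ 0 := by exact_mod_cast Fintype.card_ne_zero
  obtain ⟨ψ, hψ⟩ : ∃ ψ : AddChar L ℂ, ψ.IsPrimitive :=
    ⟨_, AddChar.FiniteField.primitiveChar_to_Complex_isPrimitive L⟩
  -- Each condition "fibre sum is `0`" is detected by averaging `ψ` over multiples `y` of that sum.
  have h1 : ∀ l : ι → Lˣ, (if ∀ w, ∑ k with f k = w, (l k : L) = 0 then (1 : ℂ) else 0) =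
      ∏ w, ((Fintype.card L : ℂ)⁻¹ * ∑ y, ψ (y * ∑ k with f k = w, (l k : L))) := fun l => by
    simp only [AddChar.sum_mulShift _ hψ]
    split_ifs with h
    · simp [h, hq]
    · push Not at h
      obtain ⟨w, hw⟩ := h
      rw [Finset.prod_eq_zero (Finset.mem_univ w)]
      simp [hw]
  have h2 : ∀ (l : ι → Lˣ) (y : W → L),
      ∏ w, ψ (y w * ∑ k with f k = w, (l k : L)) = ∏ k, ψ (l k * y (f k)) := fun l y => by
    rw [← Finset.prod_fiberwise Finset.univ f]
    refine Finset.prod_congr rfl fun w _ => ?_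
    rw [Finset.mul_sum, AddChar.map_finset_sum]
    refine Finset.prod_congr rfl fun k hk => ?_
    rw [(Finset.mem_filter.1 hk).2, mul_comm]
  have h3 : ((Finset.card {l : ι → Lˣ | ∀ w, ∑ k with f k = w, (l k : L) = 0} : ℕ) : ℂ) =
      ∏ w, ((Fintype.card L : ℂ)⁻¹ * ∑ y : L, ((if y = 0 then (Fintype.card L : ℂ) else 0) - 1) ^
        (Finset.card {k | f k = w})) := by
    rw [Finset.card_filter, Nat.cast_sum]
    simp only [Nat.cast_ite, Nat.cast_one, Nat.cast_zero, h1]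
    simp only [Finset.prod_mul_distrib, Finset.prod_const, Finset.prod_univ_sum, h2,
      ← Finset.mul_sum]
    congr 1
    rw [Finset.sum_comm]
    refine Finset.sum_congr (by simp) fun y _ => ?_
    simp only [← hψ.sum_units_mul]
    have h4 := Finset.prod_univ_sum (fun _ : ι => (Finset.univ : Finset Lˣ))
      (fun k l => ψ (l * y (f k)))
    rw [Fintype.piFinset_univ] at h4
    rw [← h4, ← Finset.prod_fiberwise Finset.univ f]
    refine Finset.prod_congr rfl fun w _ => Finset.prod_eq_pow_card fun k hk => ?_
    rw [(Finset.mem_filter.1 hk).2]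
  -- The term `y = 0` gives `(q - 1) ^ j`, and each of the other `q - 1` terms gives `(-1) ^ j`.
  have h5 : ∀ j : ℕ, (Fintype.card L : ℂ)⁻¹ *
      ∑ y : L, ((if y = 0 then (Fintype.card L : ℂ) else 0) - 1) ^ j =
        ((powerSumB (Fintype.card L) j : ℚ) : ℂ) := fun j => by
    rw [← Finset.add_sum_erase _ _ (Finset.mem_univ (0 : L)), Finset.sum_congr rfl
      (g := fun _ => (-1 : ℂ) ^ j) (fun y hy => by simp [Finset.ne_of_mem_erase hy]),
      Finset.sum_const, Finset.card_erase_of_mem (Finset.mem_univ _), Finset.card_univ, nsmul_eq_mul,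
      Nat.cast_sub Fintype.card_pos]
    simp only [powerSumB, if_true]
    push_cast
    field_simp
  simp only [h5] at h3
  exact_mod_cast h3

/-! ### Scaled families: relations, weights and moments. -/

/-- Functionals `f x` on `A` that are multiples `c x • g (v x)` of functionals `g w`, any `n` of
which are linearly independent, such that every multiple of every `g w` by a unit occurs
`e` times. -/
structure IsScaledFamily {L A X W : Type*} [Field L] [AddCommGroup A] [Module L A]
    (e n : ℕ) (f : X → Module.Dual L A) (v : X → W) (c : X → Lˣ) (g : W → Module.Dual L A) :
    Prop where
  eq_smul : ∀ x, f x = (c x : L) • g (v x)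
  card_fiber : ∀ w l, Nat.card {x // v x = w ∧ c x = l} = e
  eq_zero_of_sum : ∀ S : Finset W, S.card ≤ n → ∀ b : W → L, ∑ w ∈ S, b w • g w = 0 →
    ∀ w ∈ S, b w = 0
  finrank_eq : Module.finrank L A = n
  card_mul : Nat.card W * e = Nat.card L + 1
  le_card : n ≤ Nat.card W

namespace IsScaledFamily

variable {L A X W : Type*} [Field L] [AddCommGroup A] [Module L A] {e n : ℕ}
  {f : X → Module.Dual L A} {v : X → W} {c : X → Lˣ} {g : W → Module.Dual L A}

open Classical in
theorem sum_comp [Fintype L] [Fintype X] [Fintype W] {M : Type*} [AddCommMonoid M]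
    (H : IsScaledFamily e n f v c g) (F : W → Lˣ → M) :
    ∑ x, F (v x) (c x) = e • ∑ w, ∑ l, F w l := by
  rw [← Finset.sum_fiberwise Finset.univ fun x => (v x, c x), ← Fintype.sum_prod_type',
    Finset.smul_sum]
  refine Finset.sum_congr rfl fun y _ => ?_
  rw [← H.card_fiber y.1 y.2, Nat.card_eq_fintype_card, Fintype.card_subtype, ← Finset.sum_const]
  refine Finset.sum_congr (by ext; simp [Prod.ext_iff]) fun x hx => ?_
  obtain ⟨h1, h2⟩ := (Finset.mem_filter.1 hx).2
  rw [h1, h2]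

open Classical in
theorem sum_tuple_comp [Fintype L] [Fintype X] [Fintype W] {M : Type*} [AddCommMonoid M]
    (H : IsScaledFamily e n f v c g) (r : ℕ) (F : (Fin r → W) → (Fin r → Lˣ) → M) :
    ∑ x : Fin r → X, F (fun k => v (x k)) (fun k => c (x k)) = e ^ r • ∑ w, ∑ l, F w l := by
  rw [← Finset.sum_fiberwise Finset.univ fun x : Fin r → X =>
    ((fun k => v (x k), fun k => c (x k)) : (Fin r → W) × (Fin r → Lˣ)), ← Fintype.sum_prod_type',
    Finset.smul_sum]
  refine Finset.sum_congr rfl fun y _ => ?_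
  have h : (Fintype.piFinset fun k => {x : X | v x = y.1 k ∧ c x = y.2 k}).card = e ^ r := by
    rw [Fintype.card_piFinset, Finset.prod_congr rfl (g := fun _ => e) (fun k _ => ?_)]
    · simp
    · rw [← H.card_fiber (y.1 k) (y.2 k), Nat.card_eq_fintype_card, Fintype.card_subtype]
  rw [← h, ← Finset.sum_const]
  refine Finset.sum_congr ?_ fun x hx => ?_
  · ext x
    simp [Prod.ext_iff, funext_iff, forall_and]
  · have h' := Fintype.mem_piFinset.1 hx
    simp only [Finset.mem_filter, Finset.mem_univ, true_and] at h'
    rw [show (fun k => v (x k)) = y.1 from funext fun k => (h' k).1,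
      show (fun k => c (x k)) = y.2 from funext fun k => (h' k).2]

open Classical in
-- A sum of `r ≤ n` members involves at most `n` distinct `g w`, so it vanishes only if the scalars
-- attached to each `w` add up to `0`.
theorem card_sum_eq_zero [Fintype L] [Fintype X] [Fintype W] (H : IsScaledFamily e n f v c g)
    {r : ℕ} (hr : r ≤ n) :
    ((Finset.card {x : Fin r → X | ∑ k, f (x k) = 0} : ℕ) : ℚ) =
      powerSumN (Fintype.card L) e r := by
  have he : 0 < e := by
    refine Nat.pos_of_ne_zero fun h => ?_
    have := H.card_mul
    simp [h] at this
  have hW : Fintype.card W = (Fintype.card L + 1) / e := by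
    rw [← Nat.card_eq_fintype_card, ← Nat.card_eq_fintype_card, ← H.card_mul, Nat.mul_div_cancel _ he]
  rw [powerSumN_eq_sum_prod_card_fiber Fintype.card_ne_zero hW, Finset.card_filter]
  simp only [H.eq_smul]
  rw [H.sum_tuple_comp r fun w l => if ∑ k, (l k : L) • g (w k) = 0 then 1 else 0, smul_eq_mul]
  push_cast
  congr 1
  refine Finset.sum_congr rfl fun w _ => ?_
  rw [← card_units_sum_fiber_eq_zero, Finset.card_filter, Nat.cast_sum]
  refine Finset.sum_congr (by ext; simp) fun l _ => ?_
  rw [Nat.cast_ite, Nat.cast_one, Nat.cast_zero]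
  have h1 : ∑ k, (l k : L) • g (w k) =
      ∑ y ∈ Finset.univ.image w, (∑ k with w k = y, (l k : L)) • g y := by
    rw [← Finset.sum_fiberwise_of_maps_to (g := w) (t := Finset.univ.image w) (fun k _ => by simp)]
    refine Finset.sum_congr rfl fun y _ => ?_
    rw [Finset.sum_smul]
    refine Finset.sum_congr rfl fun k hk => ?_
    rw [(Finset.mem_filter.1 hk).2]
  refine if_congr ⟨fun h y => ?_, fun h => ?_⟩ rfl rfl
  · by_cases hy : y ∈ Finset.univ.image w
    · exact H.eq_zero_of_sum _ (Finset.card_image_le.trans (by simpa using hr)) _ (h1 ▸ h) y hy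
    · rw [Finset.filter_eq_empty_iff.2, Finset.sum_empty]
      intro k _ hk
      exact hy (Finset.mem_image.2 ⟨k, Finset.mem_univ _, hk⟩)
  · rw [h1]
    simp [h]

open Classical in
/-- A nonzero vector is annihilated by fewer than `n` of the `g w`. -/
theorem card_zeros_lt [Fintype W] (H : IsScaledFamily e n f v c g) [Module.Finite L A] {a : A}
    (ha : a ≠ 0) : Finset.card {w | g w a = 0} < n := by
  by_contra! h
  obtain ⟨S, hS, hn⟩ := Finset.exists_subset_card_eq h
  have hli : LinearIndependent L fun w : S => g w := by
    rw [Fintype.linearIndependent_iff]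
    intro b hb w
    have := H.eq_zero_of_sum S hn.le (fun w => if h : w ∈ S then b ⟨w, h⟩ else 0) (by
      rw [← Finset.sum_coe_sort, ← hb]
      simp) w w.2
    simpa using this
  -- `n` independent functionals on an `n`-dimensional space span the dual, so their only common
  -- zero is `0`.
  have htop := hli.span_eq_top_of_card_eq_finrank' (by
    rw [Fintype.card_coe, hn, Subspace.dual_finrank_eq, H.finrank_eq])
  refine ha ((Module.forall_dual_apply_eq_zero_iff L a).1 fun φ => ?_)
  have hφ : φ ∈ Submodule.span L (Set.range fun w : S => g w) := htop ▸ Submodule.mem_top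
  induction hφ using Submodule.span_induction with
  | mem φ hφ =>
    obtain ⟨w, rfl⟩ := hφ
    exact (Finset.mem_filter.1 (hS w.2)).2
  | zero => simp
  | add φ φ' _ _ h h' => simp [h, h']
  | smul k φ _ h => simp [h]

end IsScaledFamily

open Classical in
theorem AddMonoidHom.card_ne_zero_of_surjective {p : ℕ} [Fact p.Prime] {L : Type*} [AddGroup L]
    [Fintype L] (τ : L →+ ZMod p) (hτ : Function.Surjective τ) :
    ((Finset.card {x | τ x ≠ 0} : ℕ) : ℚ) = ((p : ℚ) - 1) / p * Fintype.card L := by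
  have hp : (p : ℚ) ≠ 0 := by exact_mod_cast (Fact.out : p.Prime).ne_zero
  have h1 := τ.ker.card_mul_index
  rw [AddSubgroup.index_ker, AddMonoidHom.range_eq_top.2 hτ, AddSubgroup.card_top, Nat.card_zmod,
    Nat.card_eq_fintype_card (α := L)] at h1
  have h2 : Nat.card τ.ker = Finset.card {x | τ x = 0} := by
    rw [← Fintype.card_subtype, ← Nat.card_eq_fintype_card]
    rfl
  have h3 := Finset.card_filter_add_card_filter_not (s := Finset.univ) fun x => τ x = 0
  rw [Finset.card_univ] at h3
  rw [h2] at h1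
  have h1' : ((Finset.card {x | τ x = 0} : ℕ) : ℚ) * p = Fintype.card L := by exact_mod_cast h1
  have h3' : ((Finset.card {x | τ x = 0} : ℕ) : ℚ) + (Finset.card {x | τ x ≠ 0} : ℕ) =
    Fintype.card L := by exact_mod_cast h3
  field_simp
  linear_combination (p : ℚ) * h3' - h1'

theorem momentMatrix_eq (q e n : ℕ) : momentMatrix q e n =
    (Matrix.vandermonde fun j : Fin n => ((j : ℕ) : ℚ) * e * q - q - 1).transpose := by
  ext i j
  simp [momentMatrix, Matrix.vandermonde_apply]

theorem isUnit_det_momentMatrix {q e : ℕ} (hq : q ≠ 0) (he : e ≠ 0) (n : ℕ) :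
    IsUnit (momentMatrix q e n).det := by
  rw [momentMatrix_eq, Matrix.det_transpose, isUnit_iff_ne_zero, Matrix.det_vandermonde_ne_zero_iff]
  intro i j h
  have hq' : (q : ℚ) ≠ 0 := by exact_mod_cast hq
  have he' : (e : ℚ) ≠ 0 := by exact_mod_cast he
  have h' : ((i : ℕ) : ℚ) = (j : ℕ) := by
    refine mul_right_cancel₀ he' (mul_right_cancel₀ hq' ?_)
    simpa using h
  exact Fin.ext (by exact_mod_cast h')

namespace IsScaledFamily

variable {L A X W : Type*} [Field L] [AddCommGroup A] [Module L A] {e n : ℕ}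
  {f : X → Module.Dual L A} {v : X → W} {c : X → Lˣ} {g : W → Module.Dual L A}

theorem pos (H : IsScaledFamily e n f v c g) [Finite L] : e ≠ 0 := fun h => by
  have := H.card_mul
  simp [h] at this

open Classical in
-- If `g w a ≠ 0`, the products `l * g w a` run once through the units of `L`, and a proportion `(p
-- - 1) / p` of `L` avoids the kernel of `τ`. If `g w a = 0`, nothing is contributed.
theorem card_ne_zero [Fintype L] [Fintype X] [Fintype W] {p : ℕ} [Fact p.Prime]
    (H : IsScaledFamily e n f v c g) (τ : L →+ ZMod p) (hτ : Function.Surjective τ) (a : A) :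
    ((Finset.card {x | τ (f x a) ≠ 0} : ℕ) : ℚ) = ((p : ℚ) - 1) / p *
      ((Fintype.card L : ℚ) * (Fintype.card L + 1 - e * (Finset.card {w | g w a = 0} : ℕ))) := by
  rw [Finset.card_filter]
  simp only [H.eq_smul, LinearMap.smul_apply, smul_eq_mul]
  rw [H.sum_comp fun w l => if τ (l * g w a) ≠ 0 then 1 else 0]
  have h1 : ∀ w, ∑ l : Lˣ, (if τ (l * g w a) ≠ 0 then 1 else 0) =
      if g w a = 0 then 0 else Finset.card {x | τ x ≠ 0} := fun w => by
    split_ifs with h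
    · simp [h]
    · zify
      rw [sum_units_eq_sum_sub fun x => if τ (x * g w a) ≠ 0 then (1 : ℤ) else 0, zero_mul,
        map_zero, if_neg (by simp), sub_zero, Finset.card_filter, Nat.cast_sum]
      simp only [Nat.cast_ite, Nat.cast_one, Nat.cast_zero]
      exact Equiv.sum_comp (Equiv.mulRight₀ (g w a) h) fun x => if τ x ≠ 0 then (1 : ℤ) else 0
  have h2 := Finset.card_filter_add_card_filter_not (s := Finset.univ) fun w => g w a = 0
  have h3 := H.card_mul
  rw [Nat.card_eq_fintype_card, Nat.card_eq_fintype_card, ← Finset.card_univ, ← h2] at h3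
  simp only [h1]
  rw [Finset.sum_ite, Finset.sum_const_zero, zero_add, Finset.sum_const, smul_eq_mul, smul_eq_mul]
  push_cast
  rw [AddMonoidHom.card_ne_zero_of_surjective τ hτ]
  have h3' : (((Finset.card {w | g w a = 0} : ℕ) : ℚ) + (Finset.card {w | ¬ g w a = 0} : ℕ)) * e =
    Fintype.card L + 1 := by exact_mod_cast h3
  linear_combination ((p : ℚ) - 1) / p * Fintype.card L * h3'

open Classical in
-- The base on the left is the character sum `∑ x, ψ (f x a)`. Expanding its power and using
-- orthogonality over `a` keeps only the tuples with `∑ f (x_k) = 0`.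
theorem sum_pow_eq [Fintype L] [Fintype X] [Fintype W] [Fintype A]
    (H : IsScaledFamily e n f v c g) (r : ℕ) :
    ∑ a, ((Fintype.card L : ℚ) * e * (Finset.card {w | g w a = 0} : ℕ) -
      (Fintype.card L + 1)) ^ r =
      (Fintype.card L : ℚ) ^ n * (Finset.card {x : Fin r → X | ∑ k, f (x k) = 0} : ℕ) := by
  obtain ⟨ψ, hψ⟩ : ∃ ψ : AddChar L ℂ, ψ.IsPrimitive :=
    ⟨_, AddChar.FiniteField.primitiveChar_to_Complex_isPrimitive L⟩
  have h1 : ∀ a, ∑ x, ψ (f x a) = (Fintype.card L : ℂ) * e * (Finset.card {w | g w a = 0} : ℕ) -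
      (Fintype.card L + 1) := fun a => by
    simp only [H.eq_smul, LinearMap.smul_apply, smul_eq_mul]
    rw [H.sum_comp fun w l => ψ (l * g w a)]
    simp only [hψ.sum_units_mul]
    have h3 := H.card_mul
    rw [Nat.card_eq_fintype_card, Nat.card_eq_fintype_card] at h3
    have h3' : (Fintype.card W : ℂ) * e = Fintype.card L + 1 := by exact_mod_cast h3
    rw [Finset.sum_sub_distrib, ← Finset.sum_filter, Finset.sum_const, Finset.sum_const,
      Finset.card_univ, nsmul_eq_mul, nsmul_eq_mul, nsmul_eq_mul, ← h3']
    ring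
  have h2 : ∀ φ : Module.Dual L A, ∑ a, ψ (φ a) =
      if φ = 0 then (Fintype.card L : ℂ) ^ n else 0 := fun φ => by
    split_ifs with h
    · have : Fintype.card A = Fintype.card L ^ n := by
        rw [← H.finrank_eq]
        exact Module.card_eq_pow_finrank
      simp [h, this]
    · refine AddChar.sum_eq_zero_of_ne_one (ψ := ψ.compAddMonoidHom φ.toAddMonoidHom) fun h1 => ?_
      refine hψ (one_ne_zero) (DFunLike.ext _ _ fun y => ?_)
      obtain ⟨a, rfl⟩ := LinearMap.surjective h y
      simpa [AddChar.mulShift_apply] using DFunLike.congr_fun h1 a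
  have h3 : ∑ a, (∑ x, ψ (f x a)) ^ r =
      (Fintype.card L : ℂ) ^ n * (Finset.card {x : Fin r → X | ∑ k, f (x k) = 0} : ℕ) := by
    simp only [Fintype.sum_pow, ← AddChar.map_finset_sum, ← LinearMap.sum_apply]
    rw [Finset.sum_comm]
    simp only [h2]
    rw [← Finset.sum_filter, Finset.sum_const, nsmul_eq_mul, mul_comm]
  simp only [h1] at h3
  exact_mod_cast h3

open Classical in
-- The moments of `sum_pow_eq`, with the `a` grouped by their number of zeros and the term `a = 0`
-- moved to the other side.
theorem mulVec_card_zeros [Fintype L] [Fintype X] [Fintype W] [Fintype A]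
    (H : IsScaledFamily e n f v c g) :
    (momentMatrix (Fintype.card L) e n).mulVec
      (fun j => ((Finset.card {a | Finset.card {w | g w a = 0} = (j : ℕ)} : ℕ) : ℚ)) =
        momentVector (Fintype.card L) e n := by
  ext i
  have h1 := (H.sum_pow_eq i).trans
    (c := (Fintype.card L : ℚ) ^ n * powerSumN (Fintype.card L) e i) (by
      rw [← H.card_sum_eq_zero (r := i) i.2.le]
      congr!)
  have h3 := H.card_mul
  rw [Nat.card_eq_fintype_card, Nat.card_eq_fintype_card] at h3
  have h3' : (Fintype.card W : ℚ) * e = Fintype.card L + 1 := by exact_mod_cast h3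
  have hW := H.le_card
  rw [Nat.card_eq_fintype_card] at hW
  rw [← Finset.add_sum_erase _ _ (Finset.mem_univ 0),
    ← Finset.sum_fiberwise_of_maps_to (g := fun a => Finset.card {w | g w a = 0})
      (t := Finset.range n) (fun a ha => Finset.mem_range.2
        (H.card_zeros_lt (Finset.ne_of_mem_erase ha)))] at h1
  simp only [map_zero, Finset.filter_true, Finset.card_univ] at h1
  rw [Finset.sum_range] at h1
  rw [momentVector, ← h1]
  have h4 : ((Fintype.card L : ℚ) * e * (Fintype.card W : ℚ) - (Fintype.card L + 1)) =
      (Fintype.card L : ℚ) ^ 2 - 1 := by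
    linear_combination (Fintype.card L : ℚ) * h3'
  rw [h4, add_sub_cancel_left]
  simp only [Matrix.mulVec, dotProduct]
  refine Finset.sum_congr rfl fun j _ => ?_
  -- The vector `0` has `|W| ≥ n > j` zeros, so it never enters these counts.
  have h5 : ({a | Finset.card {w | g w a = 0} = (j : ℕ)} : Finset A) =
      {a ∈ Finset.univ.erase (0 : A) | Finset.card {w | g w a = 0} = (j : ℕ)} := by
    ext a
    simp only [Finset.mem_filter, Finset.mem_univ, true_and, Finset.mem_erase, and_true]
    refine ⟨fun h => ⟨fun h0 => ?_, h⟩, fun h => h.2⟩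
    have := j.2
    simp [h0] at h
    omega
  rw [h5, Finset.sum_congr rfl (g := fun _ => momentMatrix (Fintype.card L) e n i j)
    (fun a ha => ?_), Finset.sum_const, nsmul_eq_mul, mul_comm]
  rw [(Finset.mem_filter.1 ha).2]
  simp only [momentMatrix, Matrix.of_apply]
  ring

/-- The weight distribution of the code of the words `(τ (f x a))_x`. -/
theorem weightFrequency_eq [Finite L] [Finite X] [Finite W] [Finite A] {p q M : ℕ} [Fact p.Prime]
    (H : IsScaledFamily e n f v c g) (hq : Nat.card L = q) (τ : L →+ ZMod p)
    (hτ : Function.Surjective τ) (ξ : Fin M ≃ X) {C : Set (Fin M → ZMod p)}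
    (hC : ∀ u, u ∈ C ↔ ∃ a, ∀ i, u i = τ (f (ξ i) a)) :
    IsUnit (momentMatrix q e n).det ∧
      (fun j : Fin n => (weightFrequency C
        (((p : ℚ) - 1) / p * ((q : ℚ) ^ 2 - (((j : ℕ) : ℚ) * e - 1) * q)) : ℚ)) =
          Matrix.mulVec (momentMatrix q e n)⁻¹ (momentVector q e n) ∧
      ∀ r ≤ n, ({x : Fin r → X | ∑ k, f (x k) = 0}.ncard : ℚ) = powerSumN q e r := by
  classical
  have := Fintype.ofFinite L
  have := Fintype.ofFinite X
  have := Fintype.ofFinite W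
  have := Fintype.ofFinite A
  rw [Nat.card_eq_fintype_card] at hq
  subst hq
  have hdet := isUnit_det_momentMatrix (q := Fintype.card L) Fintype.card_ne_zero H.pos n
  refine ⟨hdet, ?_, fun r hr => ?_⟩
  · rw [← H.mulVec_card_zeros, Matrix.mulVec_mulVec, Matrix.nonsing_inv_mul _ hdet,
      Matrix.one_mulVec]
    ext j
    congr 1
    let word : A → Fin M → ZMod p := fun a i => τ (f (ξ i) a)
    have hp0 : ((p : ℚ) - 1) / p ≠ 0 := by
      have h1 : (1 : ℚ) < p := by exact_mod_cast (Fact.out : p.Prime).one_lt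
      exact div_ne_zero (by linarith) (by linarith)
    have hq0 : (Fintype.card L : ℚ) ≠ 0 := by exact_mod_cast Fintype.card_ne_zero
    have he0 : (e : ℚ) ≠ 0 := by exact_mod_cast H.pos
    have h3 := H.card_mul
    rw [Nat.card_eq_fintype_card, Nat.card_eq_fintype_card] at h3
    have h3' : (Fintype.card W : ℚ) * e = Fintype.card L + 1 := by exact_mod_cast h3
    have hwt : ∀ a, (hammingNorm (word a) : ℚ) = ((p : ℚ) - 1) / p * ((Fintype.card L : ℚ) *
        (Fintype.card L + 1 - e * (Finset.card {w | g w a = 0} : ℕ))) := fun a => by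
      rw [← H.card_ne_zero τ hτ a]
      congr 1
      refine Finset.card_equiv ξ fun i => ?_
      simp [word]
    -- Weight `0` forces all `|W| ≥ n` functionals to vanish at `a`. Hence words correspond to
    -- coefficient vectors, and counting one counts the other.
    have hinj : Function.Injective word := by
      have h0 : ∀ a, word a = 0 → a = 0 := fun a ha => by
        by_contra hne
        have h1 := H.card_zeros_lt hne
        have h2 := hwt a
        rw [ha, hammingNorm_zero, Nat.cast_zero, eq_comm, mul_eq_zero, mul_eq_zero] at h2
        have h4 := (h2.resolve_left hp0).resolve_left hq0
        have h5 : (Fintype.card W : ℚ) = (Finset.card {w | g w a = 0} : ℕ) :=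
          mul_right_cancel₀ he0 (by linear_combination h3' + h4)
        have h6 : Fintype.card W = Finset.card {w | g w a = 0} := by exact_mod_cast h5
        have h7 := H.le_card
        rw [Nat.card_eq_fintype_card] at h7
        omega
      intro a b hab
      refine sub_eq_zero.1 (h0 _ (funext fun i => ?_))
      have := congrFun hab i
      simp only [word] at this
      simp [word, this]
    rw [weightFrequency, ← Set.ncard_coe_finset, ← Set.ncard_image_of_injective _ hinj]
    congr 1
    ext u
    simp only [Set.mem_ofPred_eq, hC, Set.mem_image, Finset.coe_filter, Finset.mem_univ, true_and]
    have key : ∀ a, (hammingNorm (word a) : ℚ) = ((p : ℚ) - 1) / p *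
        ((Fintype.card L : ℚ) ^ 2 - (((j : ℕ) : ℚ) * e - 1) * Fintype.card L) ↔
          Finset.card {w | g w a = 0} = (j : ℕ) := fun a => by
      rw [hwt]
      refine ⟨fun h => ?_, fun h => by rw [h]; ring⟩
      have h1 := mul_left_cancel₀ hp0 h
      have h2 : ((Finset.card {w | g w a = 0} : ℕ) : ℚ) = (j : ℕ) := by
        refine mul_left_cancel₀ he0 (mul_left_cancel₀ hq0 ?_)
        linear_combination -h1
      exact_mod_cast h2
    constructor
    · rintro ⟨⟨a, ha⟩, hu⟩
      have : u = word a := funext ha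
      exact ⟨a, (key a).1 (this ▸ hu), this.symm⟩
    · rintro ⟨a, ha, rfl⟩
      exact ⟨⟨a, fun _ => rfl⟩, (key a).2 ha⟩
  · rw [← H.card_sum_eq_zero hr, ← Set.ncard_coe_finset]
    simp

end IsScaledFamily

/-! ### Independence on the rational normal curve, and fibres in a quadratic extension. -/

/-- A linear combination of at most `n` points of a rational normal curve that vanishes is
trivial; the exponents run through any `n` consecutive integers. -/
theorem eq_zero_of_sum_mul_zpow_eq_zero {K ι : Type*} [Field K] (S : Finset ι) (β : ι → Kˣ)
    (hβ : Set.InjOn β S) (C : ι → K) (n : ℕ) (hS : S.card ≤ n) (i₀ : ℤ)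
    (h : ∀ m < n, ∑ x ∈ S, C x * ((β x ^ (i₀ + m) : Kˣ) : K) = 0) : ∀ x ∈ S, C x = 0 := by
  classical
  intro x hx
  have hinj : Set.InjOn (fun x => (β x : K)) S := fun a ha b hb hab => hβ ha hb (Units.ext hab)
  -- `P` has degree below `n`, so the hypotheses combine to a relation weighted by `P`, which
  -- isolates the point `x`.
  let P := Lagrange.basis S (fun x => (β x : K)) x
  have hdeg : P.natDegree < n := by
    have h1 : P.natDegree = S.card - 1 :=
      Polynomial.natDegree_eq_of_degree_eq_some (Lagrange.degree_basis hinj hx)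
    have := Finset.card_pos.2 ⟨x, hx⟩
    omega
  have h1 : ∑ y ∈ S, C y * ((β y ^ i₀ : Kˣ) : K) * P.eval (β y : K) = 0 := by
    simp only [Polynomial.eval_eq_sum_range, Finset.mul_sum]
    rw [Finset.sum_comm]
    refine Finset.sum_eq_zero fun m hm => ?_
    have h2 := h m (by have := Finset.mem_range.1 hm; omega)
    rw [← mul_zero (P.coeff m), ← h2, Finset.mul_sum]
    refine Finset.sum_congr rfl fun y _ => ?_
    rw [zpow_add, Units.val_mul, zpow_natCast, Units.val_pow_eq_pow_val]
    ring
  have h2 : ∀ y ∈ S, y ≠ x → P.eval (β y : K) = 0 := fun y hy hne =>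
    Lagrange.eval_basis_of_ne (v := fun x => (β x : K)) hne.symm hy
  have h3 : P.eval (β x : K) = 1 := Lagrange.eval_basis_self hinj hx
  rw [Finset.sum_eq_single_of_mem x hx (fun y hy hne => by rw [h2 y hy hne, mul_zero]), h3,
    mul_one] at h1
  exact (mul_eq_zero.1 h1).resolve_right (Units.ne_zero _)

theorem card_range_powMonoidHom_mul {K : Type*} [Field K] [Finite K] {q : ℕ} (hq : 0 < q - 1)
    (hK : Nat.card K = q ^ 2) (h : ℕ) :
    Nat.card (powMonoidHom ((q - 1) * h) : Kˣ →* Kˣ).range * Nat.gcd h (q + 1) = q + 1 := by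
  have h1 : q ^ 2 - 1 = (q - 1) * (q + 1) := by
    rw [mul_comm, ← Nat.sq_sub_sq, one_pow]
  rw [IsCyclic.card_powMonoidHom_range, Nat.card_units, hK, h1, Nat.gcd_mul_left,
    Nat.mul_div_mul_left _ _ hq, Nat.gcd_comm (q + 1)]
  exact Nat.div_mul_cancel (Nat.gcd_dvd_right _ _)

section QuadraticExtension

variable {L K : Type*} [Field L] [Field K] [Finite L] [Algebra L K] {q : ℕ}

theorem exists_units_map_algebraMap_eq [Finite K] (hL : Nat.card L = q) (κ : Kˣ) (hκ : κ ^ (q - 1) = 1) :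
    ∃ l : Lˣ, Units.map (algebraMap L K : L →* K) l = κ := by
  classical
  have := Fintype.ofFinite L
  have := Fintype.ofFinite K
  rw [Nat.card_eq_fintype_card] at hL
  have hq : 0 < q - 1 := by
    have := Fintype.one_lt_card (α := L)
    omega
  have hinj : Function.Injective (Units.map (algebraMap L K : L →* K)) :=
    Units.map_injective (algebraMap L K).injective
  have hsub : Finset.univ.image (Units.map (algebraMap L K : L →* K)) ⊆
      ({κ | κ ^ (q - 1) = 1} : Finset Kˣ) := fun x hx => by
    obtain ⟨l, -, rfl⟩ := Finset.mem_image.1 hx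
    rw [Finset.mem_filter, ← map_pow, ← hL, ← Fintype.card_units, pow_card_eq_one, map_one]
    exact ⟨Finset.mem_univ _, rfl⟩
  have heq := Finset.eq_of_subset_of_card_le hsub (by
    rw [Finset.card_image_of_injective _ hinj, Finset.card_univ, Fintype.card_units, hL]
    exact IsCyclic.card_pow_eq_one_le hq)
  have hm : κ ∈ ({κ | κ ^ (q - 1) = 1} : Finset Kˣ) := by simpa using hκ
  rw [← heq] at hm
  obtain ⟨l, -, hl⟩ := Finset.mem_image.1 hm
  exact ⟨l, hl⟩

theorem units_zpow_congr [Finite K] (hK : Nat.card K = q ^ 2) {a b : ℤ}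
    (h : a ≡ b [ZMOD (q : ℤ) ^ 2 - 1])
    (x : Kˣ) : x ^ a = x ^ b := by
  have := Fintype.ofFinite K
  rw [zpow_eq_zpow_iff_modEq]
  refine h.of_dvd ?_
  have h1 : orderOf x ∣ q ^ 2 - 1 := by
    rw [← hK, ← Nat.card_units]
    exact orderOf_dvd_natCard x
  have h2 : ((q ^ 2 - 1 : ℕ) : ℤ) = (q : ℤ) ^ 2 - 1 := by
    rw [Nat.cast_sub (by rw [← hK]; exact Nat.card_pos)]
    simp
  rw [← h2]
  exact_mod_cast h1

/-- The `q`-power Frobenius fixes coefficients from `L`. This doubles the number of power sums known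
to vanish. -/
theorem sum_mul_zpow_mul_card_eq_zero {ι : Type*} (hL : Nat.card L = q) (S : Finset ι) (b : ι → L)
    (x : ι → Kˣ) (d : ℤ) (h : ∑ k ∈ S, algebraMap L K (b k) * ((x k ^ d : Kˣ) : K) = 0) :
    ∑ k ∈ S, algebraMap L K (b k) * ((x k ^ (q * d) : Kˣ) : K) = 0 := by
  have := Fintype.ofFinite L
  rw [Nat.card_eq_fintype_card] at hL
  subst hL
  have h1 : ∑ k ∈ S, (FiniteField.frobeniusAlgHom L K)
      (algebraMap L K (b k) * ((x k ^ d : Kˣ) : K)) = 0 := by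
    rw [← map_sum, h, map_zero]
  rw [← h1]
  refine Finset.sum_congr rfl fun k _ => ?_
  rw [map_mul, AlgHom.commutes, FiniteField.coe_frobeniusAlgHom]
  beta_reduce
  rw [← Units.val_pow_eq_pow_val,
    ← zpow_natCast (x k ^ d), ← zpow_mul, mul_comm d]

/-- A criterion for a family of functionals indexed by the units of a quadratic extension to be a
scaled family. -/
theorem exists_isScaledFamily [Finite K] (hL : Nat.card L = q) (hK : Nat.card K = q ^ 2) {h Δ n : ℕ}
    (hΔ : Nat.Coprime Δ (q - 1)) {A : Type*} [AddCommGroup A] [Module L A]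
    (f : Kˣ → Module.Dual L A) (D : ℤ) (hDΔ : D ≡ Δ [ZMOD (q : ℤ) - 1])
    (hD : ∀ κ : Kˣ, κ ^ ((q - 1) * h) = 1 → (κ ^ D) ^ (q - 1) = 1)
    (hf : ∀ (κ x : Kˣ) (l : Lˣ), κ ^ ((q - 1) * h) = 1 →
      Units.map (algebraMap L K : L →* K) l = κ ^ D → f (κ * x) = (l : L) • f x)
    (hind : ∀ S : Finset Kˣ, S.card ≤ n → Set.InjOn (fun x => x ^ ((q - 1) * h)) (S : Set Kˣ) →
      ∀ b : Kˣ → L, ∑ x ∈ S, b x • f x = 0 → ∀ x ∈ S, b x = 0)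
    (hn : Module.finrank L A = n)
    (hle : n ≤ Nat.card (powMonoidHom ((q - 1) * h) : Kˣ →* Kˣ).range) :
    ∃ (v : Kˣ → (powMonoidHom ((q - 1) * h) : Kˣ →* Kˣ).range) (c : Kˣ → Lˣ)
      (g : (powMonoidHom ((q - 1) * h) : Kˣ →* Kˣ).range → Module.Dual L A),
      IsScaledFamily (Nat.gcd h (q + 1)) n f v c g := by
  classical
  have := Fintype.ofFinite L
  have := Fintype.ofFinite K
  have hq : 1 < q := hL ▸ Finite.one_lt_card
  set W := (powMonoidHom ((q - 1) * h) : Kˣ →* Kˣ).range with hWdef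
  have hW := card_range_powMonoidHom_mul (K := K) (by omega) hK h
  rw [← hWdef] at hW
  let ι : Lˣ →* Kˣ := Units.map (algebraMap L K : L →* K)
  have hι : Function.Injective ι := Units.map_injective (algebraMap L K).injective
  have hcardL : Fintype.card Lˣ = q - 1 := by
    rw [Fintype.card_units, ← Nat.card_eq_fintype_card, hL]
  have hιq : ∀ l, ι l ^ (q - 1) = 1 := fun l => by
    rw [← map_pow, ← hcardL, pow_card_eq_one, map_one]
  have hιh : ∀ l, ι l ^ ((q - 1) * h) = 1 := fun l => by rw [pow_mul, hιq, one_pow]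
  have hιD : ∀ l, ι l ^ D = ι l ^ Δ := fun l => by
    rw [← zpow_natCast, zpow_eq_zpow_iff_modEq]
    refine hDΔ.of_dvd ?_
    have := orderOf_dvd_of_pow_eq_one (hιq l)
    have h2 : ((q - 1 : ℕ) : ℤ) = (q : ℤ) - 1 := by
      rw [Nat.cast_sub hq.le, Nat.cast_one]
    rw [← h2]
    exact_mod_cast this
  -- On the units of `L`, of order `q - 1`, the `D`-th power is the `Δ`-th power, a bijection by
  -- coprimality.
  have hroot : ∀ l : Lˣ, ∃ l', ι l' ^ D = ι l := fun l => by
    have hco : (Nat.card Lˣ).Coprime Δ := by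
      rw [Nat.card_eq_fintype_card, hcardL]
      exact hΔ.symm
    refine ⟨(powCoprime hco).symm l, ?_⟩
    rw [hιD, ← map_pow]
    exact congrArg ι ((powCoprime hco).apply_symm_apply l)
  choose root hroot using hroot
  let v : Kˣ → W := fun x => ⟨x ^ ((q - 1) * h), x, rfl⟩
  have hrep : ∀ w : W, ∃ x, v x = w := fun w => by
    obtain ⟨x, hx⟩ := w.2
    exact ⟨x, Subtype.ext hx⟩
  choose rep hrep using hrep
  have hv : ∀ x y, v x = v y ↔ (x * y⁻¹) ^ ((q - 1) * h) = 1 := fun x y => by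
    rw [mul_pow, inv_pow, mul_inv_eq_one, Subtype.ext_iff]
  have hc : ∀ x, ∃ l, ι l = (x * (rep (v x))⁻¹) ^ D := fun x =>
    exists_units_map_algebraMap_eq hL _ (hD _ ((hv _ _).1 (hrep _).symm))
  choose c hc using hc
  -- Every fibre of `x ↦ (v x, c x)` is a coset of the subgroup `E`.
  let E := {κ : Kˣ // κ ^ ((q - 1) * h) = 1 ∧ κ ^ D = 1}
  have hfib : ∀ w l, Nat.card {x // v x = w ∧ c x = l} = Nat.card E := fun w l => by
    refine Nat.card_congr ((Equiv.mulRight (rep w * ι (root l))⁻¹).subtypeEquiv fun x => ?_)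
    rw [Equiv.coe_mulRight]
    beta_reduce
    have h1 : v x = w ↔ (x * (rep w * ι (root l))⁻¹) ^ ((q - 1) * h) = 1 := by
      rw [← hrep w, hv, hrep, mul_inv, ← mul_assoc, mul_pow _ (ι (root l))⁻¹, inv_pow, hιh, inv_one,
        mul_one]
    refine ⟨fun hx => ⟨h1.1 hx.1, ?_⟩, fun hx => ⟨h1.2 hx.1, hι ?_⟩⟩
    · rw [mul_inv, ← mul_assoc, mul_zpow, inv_zpow, hroot, ← hx.2, hc, hx.1, mul_inv_cancel]
    · have hx1 := h1.2 hx.1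
      have hx2 := hx.2
      rw [mul_inv, ← mul_assoc, mul_zpow, inv_zpow, hroot, mul_inv_eq_one] at hx2
      rw [hc, hx1, hx2]
  -- All fibres have the same size, so `q ^ 2 - 1 = |W| (q - 1) |E|`, while `|W| gcd(h, q + 1) = q +
  -- 1`.
  have hE : Nat.card E = Nat.gcd h (q + 1) := by
    have h1 : Fintype.card Kˣ = ∑ y : W × Lˣ, Nat.card E := by
      rw [← Finset.card_univ, Finset.card_eq_sum_card_fiberwise (f := fun x => (v x, c x))
        (t := Finset.univ) (fun _ _ => Finset.mem_coe.2 (Finset.mem_univ _))]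
      refine Finset.sum_congr rfl fun y _ => ?_
      rw [← hfib y.1 y.2, Nat.card_eq_fintype_card, Fintype.card_subtype]
      congr 1
      ext
      simp [Prod.ext_iff]
    rw [Finset.sum_const, Finset.card_univ, Fintype.card_prod, hcardL, Fintype.card_units,
      ← Nat.card_eq_fintype_card, hK, ← Nat.card_eq_fintype_card (α := W), smul_eq_mul] at h1
    have h2 : q ^ 2 - 1 = (q + 1) * (q - 1) := by
      rw [← Nat.sq_sub_sq, one_pow]
    rw [h2, ← hW] at h1
    have hWpos : 0 < Nat.card W := Nat.card_pos
    have hq1 : 0 < q - 1 := by omega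
    refine Nat.eq_of_mul_eq_mul_left (Nat.mul_pos hWpos hq1) ?_
    linarith
  refine ⟨v, c, fun w => f (rep w), fun x => ?_, fun w l => (hfib w l).trans hE,
    fun S hS b hb w hw => ?_, hn, by rw [hW, hL], hle⟩
  · rw [← hf _ (rep (v x)) (c x) ((hv _ _).1 (hrep _).symm) (hc x), inv_mul_cancel_right]
  · have hri : Function.Injective rep := fun w w' hw => by rw [← hrep w, hw, hrep]
    have := hind (S.map ⟨rep, hri⟩) (by rwa [Finset.card_map]) (fun x hx y hy hxy => by
        simp only [Finset.coe_map, Set.mem_image, Finset.mem_coe, Function.Embedding.coeFn_mk]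
          at hx hy
        obtain ⟨w, -, rfl⟩ := hx
        obtain ⟨w', -, rfl⟩ := hy
        have : v (rep w) = v (rep w') := Subtype.ext hxy
        rw [hrep, hrep] at this
        rw [this]) (fun x => b (v x)) (by simpa [hrep] using hb) (rep w)
        (Finset.mem_map_of_mem _ hw)
    simpa [hrep] using this

end QuadraticExtension

/-! ### Exponents and trace functionals. -/

theorem IsHalf.two_mul_modEq {p q : ℕ} {n u : ℤ} (h : IsHalf p q n u) :
    2 * u ≡ n [ZMOD (q : ℤ) + 1] := by
  unfold IsHalf at h
  split_ifs at h
  · exact h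
  · exact h ▸ Int.ModEq.refl _

theorem IsHalf.modEq {p q : ℕ} {n u u' : ℤ} (hq : p = 2 → Even q) (h : IsHalf p q n u)
    (h' : IsHalf p q n u') : u ≡ u' [ZMOD (q : ℤ) + 1] := by
  by_cases hp : p = 2
  · obtain ⟨k, hk⟩ := hq hp
    obtain ⟨z, hz⟩ := (h.two_mul_modEq.trans h'.two_mul_modEq.symm).dvd
    -- With `q = 2k`, the difference `u' - u` equals `(q + 1) (u' - u) - k * 2 (u' - u)`.
    refine Int.modEq_iff_dvd.2 ⟨(u' - u) - k * z, ?_⟩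
    have hk' : (q : ℤ) = k + k := by exact_mod_cast hk
    rw [hk'] at hz ⊢
    linear_combination (-(k : ℤ)) * hz
  · simp only [IsHalf, if_neg hp] at h h'
    rw [show u = u' by omega]

section Functional

variable {L K : Type*} [Field L] [Field K] [Algebra L K]

/-- The functional `a ↦ Tr (∑_j a_j x ^ (d_j))`. -/
noncomputable def traceFunctional (L : Type*) {K : Type*} [Field L] [Field K] [Algebra L K] {t : ℕ}
    (d : Fin t → ℤ) (x : Kˣ) : Module.Dual L (Fin t → K) :=
  ∑ j, (Algebra.trace L K ∘ₗ LinearMap.mulRight L ((x ^ d j : Kˣ) : K)) ∘ₗ LinearMap.proj j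

theorem traceFunctional_apply {t : ℕ} (d : Fin t → ℤ) (x : Kˣ) (a : Fin t → K) :
    traceFunctional L d x a = Algebra.trace L K (∑ j, a j * ((x ^ d j : Kˣ) : K)) := by
  simp [traceFunctional]

/-- Nondegeneracy of the trace form, tested on vectors with one nonzero coordinate, turns relations
among functionals into power-sum equations. -/
theorem sum_smul_traceFunctional_eq_zero_iff [Finite L] [Finite K] {t : ℕ} (d : Fin t → ℤ)
    {ι : Type*} (S : Finset ι) (b : ι → L) (x : ι → Kˣ) :
    ∑ k ∈ S, b k • traceFunctional L d (x k) = 0 ↔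
      ∀ j, ∑ k ∈ S, algebraMap L K (b k) * ((x k ^ d j : Kˣ) : K) = 0 := by
  have h1 : ∀ a : Fin t → K, (∑ k ∈ S, b k • traceFunctional L d (x k)) a =
      Algebra.trace L K (∑ j, a j * ∑ k ∈ S, algebraMap L K (b k) * ((x k ^ d j : Kˣ) : K)) :=
    fun a => by
      simp only [LinearMap.sum_apply, LinearMap.smul_apply, traceFunctional_apply, ← map_smul,
        ← map_sum, Finset.mul_sum, Finset.smul_sum]
      rw [Finset.sum_comm]
      congr 1
      refine Finset.sum_congr rfl fun j _ => Finset.sum_congr rfl fun k _ => ?_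
      rw [Algebra.smul_def]
      ring
  refine ⟨fun h j => ?_, fun h => LinearMap.ext fun a => by
    simp only [h1, h, mul_zero, Finset.sum_const_zero, map_zero, LinearMap.zero_apply]⟩
  refine (traceForm_nondegenerate L K).2 _ fun z => ?_
  have h2 := h1 (Pi.single j z)
  rw [h, LinearMap.zero_apply, Finset.sum_eq_single j (fun i _ hi => by
    rw [Pi.single_eq_of_ne hi, zero_mul]) (by simp), Pi.single_eq_same] at h2
  rw [Algebra.traceForm_apply, ← h2]

theorem traceFunctional_mul {t : ℕ} (d : Fin t → ℤ) (κ x : Kˣ) (l : L)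
    (h : ∀ j, ((κ ^ d j : Kˣ) : K) = algebraMap L K l) :
    traceFunctional L d (κ * x) = l • traceFunctional L d x := by
  refine LinearMap.ext fun a => ?_
  rw [LinearMap.smul_apply, traceFunctional_apply, traceFunctional_apply, ← map_smul,
    Finset.smul_sum]
  congr 1
  refine Finset.sum_congr rfl fun j _ => ?_
  rw [mul_zpow, Units.val_mul, h, Algebra.smul_def]
  ring

end Functional

/-- A generator of the group of units of a field with `n` elements lists the units. -/
noncomputable def finEquivUnits {K : Type*} [Field K] [Finite K] {n : ℕ} (hK : Nat.card K = n)
    (γ : Kˣ) (hγ : ∀ x : Kˣ, x ∈ Subgroup.zpowers γ) : Fin (n - 1) ≃ Kˣ :=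
  have hord : orderOf γ = n - 1 := by
    rw [orderOf_eq_card_of_forall_mem_zpowers hγ, Nat.card_units, hK]
  Equiv.ofBijective (fun i => γ ^ (i : ℕ)) <| by
    have := Fintype.ofFinite K
    classical
    rw [Fintype.bijective_iff_injective_and_card]
    refine ⟨fun i j hij => Fin.ext (pow_injOn_Iio_orderOf (x := γ)
      (by rw [hord]; exact i.2) (by rw [hord]; exact j.2) hij), ?_⟩
    rw [Fintype.card_fin, ← Nat.card_eq_fintype_card, Nat.card_units, hK]

theorem finEquivUnits_zpow {K : Type*} [Field K] [Finite K] {n : ℕ} (hK : Nat.card K = n)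
    (γ : Kˣ) (hγ : ∀ x : Kˣ, x ∈ Subgroup.zpowers γ) (i : Fin (n - 1)) (d : ℤ) :
    finEquivUnits hK γ hγ i ^ d = γ ^ (d * (i : ℤ)) := by
  rw [mul_comm, zpow_mul, zpow_natCast]
  rfl

theorem finrank_eq_two_of_card {L K : Type*} [Field L] [Field K] [Finite L] [Finite K] [Algebra L K]
    {q : ℕ} (hL : Nat.card L = q) (hK : Nat.card K = q ^ 2) : Module.finrank L K = 2 := by
  have := Module.natCard_eq_pow_finrank (K := L) (V := K)
  rw [hK, hL] at this
  exact (Nat.pow_right_injective (hL ▸ Finite.one_lt_card : 1 < q) this).symm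

theorem Int.ModEq.mul_sub_one {q : ℕ} {a b : ℤ} (h : a ≡ b [ZMOD (q : ℤ) + 1]) :
    a * ((q : ℤ) - 1) ≡ b * ((q : ℤ) - 1) [ZMOD (q : ℤ) ^ 2 - 1] := by
  obtain ⟨z, hz⟩ := h.dvd
  exact Int.modEq_iff_dvd.2 ⟨z, by linear_combination ((q : ℤ) - 1) * hz⟩

section Exponents

variable {p q h Δ t : ℕ}

/-- The exponents of the first code in terms of a common part. -/
theorem IsExponentsOne.exists_modEq (hq : p = 2 → Even q) {d : Fin (t + 1) → ℤ}
    (hd : IsExponentsOne p q h Δ d) : ∃ D : ℤ, D ≡ Δ [ZMOD (q : ℤ) - 1] ∧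
      (q : ℤ) * D ≡ D [ZMOD (q : ℤ) ^ 2 - 1] ∧
      ∀ j, d j ≡ D + (j : ℕ) * h * ((q : ℤ) - 1) [ZMOD (q : ℤ) ^ 2 - 1] := by
  obtain ⟨-, u, hu, -⟩ := hd 0
  -- Modulo `q ^ 2 - 1` one has `(q - 1) ^ 2 ≡ -2 (q - 1)`, so `(q - 1) D ≡ (Δ - 2u) (q - 1)`, and
  -- this is `0` because `2u ≡ Δ` modulo `q + 1`.
  refine ⟨u * ((q : ℤ) - 1) + Δ, Int.modEq_iff_dvd.2 ⟨-u, by ring⟩, ?_, fun j => ?_⟩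
  · have h1 := hu.two_mul_modEq.mul_sub_one
    obtain ⟨z, hz⟩ := h1.dvd
    exact Int.modEq_iff_dvd.2 ⟨-u - z, by linear_combination -hz⟩
  · obtain ⟨s, u', hu', hs, hdj⟩ := hd j
    have h1 : s ≡ (j : ℕ) * h + u [ZMOD (q : ℤ) + 1] :=
      hs.trans ((hu'.modEq hq hu).add_left _)
    refine hdj.trans ((h1.mul_sub_one.add_right _).trans ?_)
    rw [show ((j : ℕ) * (h : ℤ) + u) * ((q : ℤ) - 1) + Δ =
      u * ((q : ℤ) - 1) + Δ + (j : ℕ) * h * ((q : ℤ) - 1) by ring]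

/-- The exponents of the second code in terms of a common part. -/
theorem IsExponentsTwo.exists_modEq (hq : p = 2 → Even q) (ht : 0 < t) {d : Fin t → ℤ}
    (hd : IsExponentsTwo p q h Δ d) : ∃ D : ℤ, D ≡ Δ [ZMOD (q : ℤ) - 1] ∧
      (q : ℤ) * D ≡ D + h * ((q : ℤ) - 1) [ZMOD (q : ℤ) ^ 2 - 1] ∧
      ∀ j, d j ≡ D + (((j : ℕ) : ℤ) + 1) * h * ((q : ℤ) - 1) [ZMOD (q : ℤ) ^ 2 - 1] := by
  obtain ⟨-, u, hu, -⟩ := hd ⟨0, ht⟩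
  -- Again `(q - 1) D ≡ (Δ - 2u) (q - 1)`; now `2u ≡ Δ - h` leaves `h (q - 1)`.
  refine ⟨u * ((q : ℤ) - 1) + Δ, Int.modEq_iff_dvd.2 ⟨-u, by ring⟩, ?_, fun j => ?_⟩
  · have h1 := hu.two_mul_modEq.mul_sub_one
    obtain ⟨z, hz⟩ := h1.dvd
    exact Int.modEq_iff_dvd.2 ⟨-u - z, by linear_combination -hz⟩
  · obtain ⟨s, u', hu', hs, hdj⟩ := hd j
    have h1 : s ≡ (((j : ℕ) : ℤ) + 1) * h + u [ZMOD (q : ℤ) + 1] :=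
      hs.trans ((hu'.modEq hq hu).add_left _)
    refine hdj.trans ((h1.mul_sub_one.add_right _).trans ?_)
    rw [show ((((j : ℕ) : ℤ) + 1) * (h : ℤ) + u) * ((q : ℤ) - 1) + Δ =
      u * ((q : ℤ) - 1) + Δ + (((j : ℕ) : ℤ) + 1) * h * ((q : ℤ) - 1) by ring]

end Exponents

theorem eq_zero_of_algebraMap_mul_units {L K : Type*} [Field L] [Field K] [Algebra L K] {b : L}
    {x : Kˣ} (hb : algebraMap L K b * (x : K) = 0) :
    b = 0 :=
  (map_eq_zero (algebraMap L K)).1 ((mul_eq_zero.1 hb).resolve_right (Units.ne_zero _))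

/-! ### The two codes as scaled families. -/

section ScaledFamilies

variable {L K : Type*} [Field L] [Field K] [Finite L] [Finite K] [Algebra L K] {q h Δ t : ℕ}

theorem units_zpow_mul_sub_one {G : Type*} [CommGroup G] (hq : 0 < q) (x : G) (z : ℤ) :
    x ^ (z * (h : ℤ) * ((q : ℤ) - 1)) = (x ^ ((q - 1) * h)) ^ z := by
  rw [← zpow_natCast x, ← zpow_mul]
  congr 1
  push_cast [hq]
  ring

theorem units_zpow_of_modEq_add (hK : Nat.card K = q ^ 2) (hq : 0 < q) {a D z : ℤ}
    (ha : a ≡ D + z * h * ((q : ℤ) - 1) [ZMOD (q : ℤ) ^ 2 - 1]) (x : Kˣ) :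
    x ^ a = x ^ D * (x ^ ((q - 1) * h)) ^ z := by
  rw [units_zpow_congr hK ha, zpow_add, units_zpow_mul_sub_one hq]

/-- Since `q * (q - 1) ≡ -(q - 1)` modulo `q ^ 2 - 1`, Frobenius reflects the index `z` to `z' - z`.
-/
theorem mul_modEq_of_modEq_add {a D D' z z' : ℤ}
    (ha : a ≡ D + z * h * ((q : ℤ) - 1) [ZMOD (q : ℤ) ^ 2 - 1])
    (hD : (q : ℤ) * D ≡ D' + z' * h * ((q : ℤ) - 1) [ZMOD (q : ℤ) ^ 2 - 1]) :
    (q : ℤ) * a ≡ D' + (z' - z) * h * ((q : ℤ) - 1) [ZMOD (q : ℤ) ^ 2 - 1] := by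
  obtain ⟨y, hy⟩ := ha.dvd
  obtain ⟨y', hy'⟩ := hD.dvd
  exact Int.modEq_iff_dvd.2
    ⟨q * y + y' - z * h, by linear_combination (q : ℤ) * hy + hy'⟩

theorem exists_isScaledFamily_traceFunctional (hL : Nat.card L = q) (hK : Nat.card K = q ^ 2)
    (hΔ : Nat.Coprime Δ (q - 1)) {d : Fin t → ℤ} {D : ℤ} (hDΔ : D ≡ Δ [ZMOD (q : ℤ) - 1])
    (hDq : (q : ℤ) * D ≡ D + h * ((q : ℤ) - 1) [ZMOD (q : ℤ) ^ 2 - 1])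
    (hd : ∀ j, d j ≡ D + (((j : ℕ) : ℤ) + 1) * h * ((q : ℤ) - 1) [ZMOD (q : ℤ) ^ 2 - 1])
    (hle : 2 * t ≤ Nat.card (powMonoidHom ((q - 1) * h) : Kˣ →* Kˣ).range) :
    ∃ (v : Kˣ → (powMonoidHom ((q - 1) * h) : Kˣ →* Kˣ).range) (c : Kˣ → Lˣ)
      (g : (powMonoidHom ((q - 1) * h) : Kˣ →* Kˣ).range → Module.Dual L (Fin t → K)),
      IsScaledFamily (Nat.gcd h (q + 1)) (2 * t) (traceFunctional L d) v c g := by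
  have hq : 0 < q := hL ▸ Finite.card_pos
  have hDq' : (q : ℤ) * D ≡ D + 1 * h * ((q : ℤ) - 1) [ZMOD (q : ℤ) ^ 2 - 1] := by
    rwa [one_mul]
  refine exists_isScaledFamily hL hK hΔ _ D hDΔ (fun κ hκ => ?_) (fun κ x l hκ hl => ?_)
    (fun S hS hinj b hb x hx => ?_) ?_ hle
  · have h1 := units_zpow_of_modEq_add hK hq hDq' κ
    rw [hκ, one_zpow, mul_one] at h1
    rw [← zpow_natCast, ← zpow_mul, Nat.cast_sub hq, Nat.cast_one, mul_sub, mul_one, mul_comm D,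
      zpow_sub, h1, mul_inv_cancel]
  · refine traceFunctional_mul d κ x (l : L) fun j => ?_
    rw [units_zpow_of_modEq_add hK hq (hd j), hκ, one_zpow, mul_one, ← hl]
    rfl
  · rw [sum_smul_traceFunctional_eq_zero_iff] at hb
    -- The `d_j` supply the indices `1, …, t` and the `q d_j` the reflected ones `1 - j`, filling
    -- the window from `1 - t` to `t`.
    refine eq_zero_of_algebraMap_mul_units (x := x ^ D) (eq_zero_of_sum_mul_zpow_eq_zero S _ hinj
      (fun x => algebraMap L K (b x) * ((x ^ D : Kˣ) : K)) (2 * t) hS (1 - t) (fun m hm => ?_) x hx)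
    have key : ∀ (a i : ℤ), a ≡ D + i * h * ((q : ℤ) - 1) [ZMOD (q : ℤ) ^ 2 - 1] →
        ∑ x ∈ S, algebraMap L K (b x) * ((x ^ a : Kˣ) : K) = 0 → i = 1 - t + m →
        ∑ x ∈ S, algebraMap L K (b x) * ((x ^ D : Kˣ) : K) *
          (((x ^ ((q - 1) * h)) ^ (1 - (t : ℤ) + m) : Kˣ) : K) = 0 := fun a i ha h0 hi => by
      rw [← h0]
      refine Finset.sum_congr rfl fun x _ => ?_
      rw [units_zpow_of_modEq_add hK hq ha, hi, Units.val_mul, mul_assoc]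
    by_cases hmt : t ≤ m
    · exact key _ _ (hd ⟨m - t, by omega⟩) (hb _) (by push_cast [hmt]; ring)
    · exact key _ _ (mul_modEq_of_modEq_add (hd ⟨t - 1 - m, by omega⟩) hDq')
        (sum_mul_zpow_mul_card_eq_zero hL S b _ _ (hb _)) (by
          rw [Nat.cast_sub (by omega), Nat.cast_sub (by omega)]
          push_cast
          ring)
  · have := Module.Finite.of_finite (R := L) (M := K)
    rw [Module.finrank_pi_fintype]
    simp [finrank_eq_two_of_card hL hK, mul_comm]

/-- The functional `(a_0, a) ↦ a_0 y + Tr (∑_j a_j x ^ (d_j))`. -/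
noncomputable def traceFunctionalCons (d : Fin t → ℤ) (y : L) (x : Kˣ) :
    Module.Dual L (L × (Fin t → K)) :=
  (LinearMap.mulRight L y).coprod (traceFunctional L d x)

theorem sum_smul_traceFunctionalCons_eq_zero_iff {d₀ : ℤ} (d : Fin t → ℤ) {y : Kˣ → L}
    (hy : ∀ x, algebraMap L K (y x) = ((x ^ d₀ : Kˣ) : K)) {ι : Type*} (S : Finset ι) (b : ι → L)
    (x : ι → Kˣ) :
    ∑ k ∈ S, b k • traceFunctionalCons d (y (x k)) (x k) = 0 ↔
      ∑ k ∈ S, algebraMap L K (b k) * ((x k ^ d₀ : Kˣ) : K) = 0 ∧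
      ∀ j, ∑ k ∈ S, algebraMap L K (b k) * ((x k ^ d j : Kˣ) : K) = 0 := by
  rw [← sum_smul_traceFunctional_eq_zero_iff]
  have h1 : ∀ a, (∑ k ∈ S, b k • traceFunctionalCons d (y (x k)) (x k)) a =
      a.1 * ∑ k ∈ S, b k * y (x k) + (∑ k ∈ S, b k • traceFunctional L d (x k)) a.2 := fun a => by
    simp only [LinearMap.sum_apply, LinearMap.smul_apply, traceFunctionalCons,
      LinearMap.coprod_apply, LinearMap.mulRight_apply, smul_eq_mul, mul_add, Finset.sum_add_distrib,
      Finset.mul_sum]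
    congr 1
    exact Finset.sum_congr rfl fun k _ => by ring
  have h2 : ∑ k ∈ S, algebraMap L K (b k) * ((x k ^ d₀ : Kˣ) : K) =
      algebraMap L K (∑ k ∈ S, b k * y (x k)) := by
    simp only [map_sum, map_mul, hy]
  rw [h2, map_eq_zero]
  refine ⟨fun h => ⟨?_, LinearMap.ext fun a => ?_⟩, fun h => LinearMap.ext fun a => ?_⟩
  · have := h1 (1, 0)
    rw [h] at this
    simpa using this.symm
  · have := h1 (0, a)
    rw [h] at this
    simpa using this.symm
  · rw [h1, h.1, h.2]
    simp

theorem exists_isScaledFamily_traceFunctionalCons (hL : Nat.card L = q) (hK : Nat.card K = q ^ 2)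
    (hΔ : Nat.Coprime Δ (q - 1)) {d : Fin (t + 1) → ℤ} {D : ℤ} (hDΔ : D ≡ Δ [ZMOD (q : ℤ) - 1])
    (hDq : (q : ℤ) * D ≡ D [ZMOD (q : ℤ) ^ 2 - 1])
    (hd : ∀ j, d j ≡ D + (j : ℕ) * h * ((q : ℤ) - 1) [ZMOD (q : ℤ) ^ 2 - 1]) {y : Kˣ → L}
    (hy : ∀ x, algebraMap L K (y x) = ((x ^ d 0 : Kˣ) : K))
    (hle : 2 * t + 1 ≤ Nat.card (powMonoidHom ((q - 1) * h) : Kˣ →* Kˣ).range) :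
    ∃ (v : Kˣ → (powMonoidHom ((q - 1) * h) : Kˣ →* Kˣ).range) (c : Kˣ → Lˣ)
      (g : (powMonoidHom ((q - 1) * h) : Kˣ →* Kˣ).range → Module.Dual L (L × (Fin t → K))),
      IsScaledFamily (Nat.gcd h (q + 1)) (2 * t + 1)
        (fun x => traceFunctionalCons (fun j => d j.succ) (y x) x) v c g := by
  have hq : 0 < q := hL ▸ Finite.card_pos
  have hDq' : (q : ℤ) * D ≡ D + 0 * h * ((q : ℤ) - 1) [ZMOD (q : ℤ) ^ 2 - 1] := by
    rwa [zero_mul, zero_mul, add_zero]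
  refine exists_isScaledFamily hL hK hΔ _ D hDΔ (fun κ hκ => ?_) (fun κ x l hκ hl => ?_)
    (fun S hS hinj b hb x hx => ?_) ?_ hle
  · have h1 := units_zpow_of_modEq_add hK hq hDq' κ
    rw [hκ, one_zpow, mul_one] at h1
    rw [← zpow_natCast, ← zpow_mul, Nat.cast_sub hq, Nat.cast_one, mul_sub, mul_one, mul_comm D,
      zpow_sub, h1, mul_inv_cancel]
  · have h1 : ∀ j, ((κ ^ d j : Kˣ) : K) = algebraMap L K l := fun j => by
      rw [units_zpow_of_modEq_add hK hq (hd j), hκ, one_zpow, mul_one, ← hl]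
      rfl
    have h2 : y (κ * x) = l * y x := (algebraMap L K).injective (by
      rw [hy, map_mul, hy, mul_zpow, Units.val_mul, h1])
    refine LinearMap.ext fun a => ?_
    simp only [traceFunctionalCons, LinearMap.coprod_apply, LinearMap.mulRight_apply,
      LinearMap.smul_apply, smul_eq_mul, h2, traceFunctional_mul _ κ x (l : L) fun j => h1 j.succ]
    ring
  · rw [sum_smul_traceFunctionalCons_eq_zero_iff _ hy] at hb
    have hb' : ∀ j, ∑ x ∈ S, algebraMap L K (b x) * ((x ^ d j : Kˣ) : K) = 0 :=
      Fin.cases hb.1 hb.2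
    -- Here the reflection is `j ↦ -j` and fixes `0`, so the window runs from `-t` to `t`: `2t + 1`
    -- indices, index `0` being the single coordinate in `L`.
    refine eq_zero_of_algebraMap_mul_units (x := x ^ D) (eq_zero_of_sum_mul_zpow_eq_zero S _ hinj
      (fun x => algebraMap L K (b x) * ((x ^ D : Kˣ) : K)) (2 * t + 1) hS (-t) (fun m hm => ?_)
      x hx)
    have key : ∀ (a i : ℤ), a ≡ D + i * h * ((q : ℤ) - 1) [ZMOD (q : ℤ) ^ 2 - 1] →
        ∑ x ∈ S, algebraMap L K (b x) * ((x ^ a : Kˣ) : K) = 0 → i = -t + m →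
        ∑ x ∈ S, algebraMap L K (b x) * ((x ^ D : Kˣ) : K) *
          (((x ^ ((q - 1) * h)) ^ (-(t : ℤ) + m) : Kˣ) : K) = 0 := fun a i ha h0 hi => by
      rw [← h0]
      refine Finset.sum_congr rfl fun x _ => ?_
      rw [units_zpow_of_modEq_add hK hq ha, hi, Units.val_mul, mul_assoc]
    by_cases hmt : t ≤ m
    · exact key _ _ (hd ⟨m - t, by omega⟩) (hb' _) (by push_cast [hmt]; ring)
    · exact key _ _ (mul_modEq_of_modEq_add (hd ⟨t - m, by omega⟩) hDq')
        (sum_mul_zpow_mul_card_eq_zero hL S b _ _ (hb' _)) (by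
          rw [Nat.cast_sub (by omega)]
          ring)
  · have := Module.Finite.of_finite (R := L) (M := K)
    rw [Module.finrank_prod, Module.finrank_pi_fintype]
    simp [finrank_eq_two_of_card hL hK]
    ring

end ScaledFamilies

/-! ### The weight distributions. -/

theorem theorem2 (p m : ℕ) [Fact p.Prime] (hm : 0 < m) (q : ℕ) (hq : q = p ^ m)
    (L K : Type*) [Field L] [Field K] [Algebra L K] [Algebra (ZMod p) L] [Algebra (ZMod p) K]
    (hL : Nat.card L = q) (hK : Nat.card K = q ^ 2)
    (γ : Kˣ) (hγ : ∀ x : Kˣ, x ∈ Subgroup.zpowers γ)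
    (h Δ : ℕ) (hh : 0 < h) (hΔ : 0 < Δ) (hhq : ¬ q + 1 ∣ h) (hΔq : Nat.Coprime Δ (q - 1))
    (e : ℕ) (he : e = Nat.gcd h (q + 1)) :
    (p = 2 → ∀ (t : ℕ), (t : ℚ) ≤ ((q : ℚ) + 1) / (2 * e) →
      ∀ d : Fin (t + 1) → ℤ, IsExponentsOne p q h Δ d →
        IsUnit (momentMatrix q e (2 * t + 1)).det ∧
        (fun j : Fin (2 * t + 1) => (weightFrequency (nihoCodeOne p q L K γ d)
            (((q : ℚ) ^ 2 - (((j : ℕ) : ℚ) * e - 1) * q) / 2) : ℚ)) =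
          Matrix.mulVec (momentMatrix q e (2 * t + 1))⁻¹ (momentVector q e (2 * t + 1)) ∧
        ∀ r ≤ 2 * t + 1, (powerSumCount K d r : ℚ) = powerSumN q e r) ∧
    (∀ (t : ℕ), 1 ≤ t → (t : ℚ) ≤ ((q : ℚ) + 1) / (2 * e) → (p ≠ 2 → Odd h) →
      ∀ d : Fin t → ℤ, IsExponentsTwo p q h Δ d →
        IsUnit (momentMatrix q e (2 * t)).det ∧
        (fun j : Fin (2 * t) => (weightFrequency (nihoCodeTwo p q K γ d)
            (((p : ℚ) - 1) / p * ((q : ℚ) ^ 2 - (((j : ℕ) : ℚ) * e - 1) * q)) : ℚ)) =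
          Matrix.mulVec (momentMatrix q e (2 * t))⁻¹ (momentVector q e (2 * t)) ∧
        ∀ r ≤ 2 * t, (powerSumCount K d r : ℚ) = powerSumN q e r) := by
  have hp : p.Prime := Fact.out
  have hq1 : 1 < q := hq ▸ Nat.one_lt_pow hm.ne' hp.one_lt
  have : Finite L := Nat.finite_of_card_ne_zero (by omega)
  have : Finite K := Nat.finite_of_card_ne_zero (by rw [hK]; positivity)
  have : IsScalarTower (ZMod p) L K := IsScalarTower.of_algebraMap_eq' (Subsingleton.elim _ _)
  have : Module.Finite (ZMod p) L := Module.Finite.of_finite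
  have : Module.Finite L K := Module.Finite.of_finite
  have heven : p = 2 → Even q := fun h2 => by
    rw [hq, h2]
    exact (Nat.even_pow.2 ⟨even_two, hm.ne'⟩)
  have hτ : Function.Surjective (Algebra.trace (ZMod p) L).toAddMonoidHom :=
    Algebra.trace_surjective (ZMod p) L
  have hW := card_range_powMonoidHom_mul (K := K) (by omega) hK h
  rw [← he] at hW
  have he0 : 0 < e := he ▸ Nat.gcd_pos_of_pos_left _ hh
  have hle : ∀ t : ℕ, (t : ℚ) ≤ ((q : ℚ) + 1) / (2 * e) →
      2 * t ≤ Nat.card (powMonoidHom ((q - 1) * h) : Kˣ →* Kˣ).range := fun t ht => by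
    have he0' : (0 : ℚ) < e := by exact_mod_cast he0
    rw [le_div_iff₀ (by positivity)] at ht
    have ht' : t * (2 * e) ≤ q + 1 := by exact_mod_cast ht
    rw [← hW] at ht'
    exact Nat.le_of_mul_le_mul_right (by linarith) he0
  have hξ := finEquivUnits_zpow hK γ hγ
  refine ⟨fun h2 t ht d hd => ?_, fun t ht1 ht _ d hd => ?_⟩
  · obtain ⟨D, hDΔ, hDq, hdj⟩ := hd.exists_modEq heven
    -- For even `q`, `|W| e = q + 1` is odd, so `2t ≤ |W|` cannot be an equality.
    have hle' : 2 * t + 1 ≤ Nat.card (powMonoidHom ((q - 1) * h) : Kˣ →* Kˣ).range := by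
      refine Nat.lt_of_le_of_ne (hle t ht) fun h1 => ?_
      rw [← h1] at hW
      have h3 : Even (q + 1) := hW ▸ (even_two_mul t).mul_right e
      exact Nat.not_even_iff_odd.2 (heven h2).add_one h3
    -- `q d_0 ≡ d_0` modulo `q ^ 2 - 1` puts every `x ^ d_0` in `L`.
    have hy : ∀ x : Kˣ, ∃ y : L, algebraMap L K y = ((x ^ d 0 : Kˣ) : K) := fun x => by
      obtain ⟨l, hl⟩ := exists_units_map_algebraMap_eq (L := L) hL (x ^ d 0) (by
        have h1 : (q : ℤ) * d 0 ≡ d 0 [ZMOD (q : ℤ) ^ 2 - 1] := by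
          have h0 : d 0 ≡ D [ZMOD (q : ℤ) ^ 2 - 1] := by simpa using hdj 0
          exact (h0.mul_left _).trans (hDq.trans h0.symm)
        rw [← zpow_natCast, ← zpow_mul, Nat.cast_sub hq1.le, Nat.cast_one, mul_sub, mul_one,
          mul_comm (d 0), zpow_sub, units_zpow_congr hK h1, mul_inv_cancel])
      exact ⟨l, congrArg Units.val hl⟩
    choose y hy using hy
    obtain ⟨v, c, g, H⟩ := exists_isScaledFamily_traceFunctionalCons hL hK hΔq hDΔ hDq hdj hy hle'
    rw [← he] at H
    obtain ⟨h1, h2', h3⟩ := H.weightFrequency_eq (p := p) hL _ hτ (finEquivUnits hK γ hγ)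
      (C := nihoCodeOne p q L K γ d) (fun u => by
        have h5 : ∀ (a₀ : L) (a : Fin t → K) (i : Fin (q ^ 2 - 1)),
            (∃ z : L, algebraMap L K z = algebraMap L K a₀ * ((γ ^ (d 0 * (i : ℤ)) : Kˣ) : K) ∧
              u i = Algebra.trace (ZMod p) L z + Algebra.trace (ZMod p) K
                (∑ j : Fin t, a j * ((γ ^ (d j.succ * (i : ℤ)) : Kˣ) : K))) ↔
            u i = (Algebra.trace (ZMod p) L).toAddMonoidHom
              (traceFunctionalCons (fun j => d j.succ) (y (finEquivUnits hK γ hγ i))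
                (finEquivUnits hK γ hγ i) (a₀, a)) := fun a₀ a i => by
          have h6 : algebraMap L K (a₀ * y (finEquivUnits hK γ hγ i)) =
              algebraMap L K a₀ * ((γ ^ (d 0 * (i : ℤ)) : Kˣ) : K) := by
            rw [map_mul, hy, hξ]
          have h7 : (Algebra.trace (ZMod p) L).toAddMonoidHom
              (traceFunctionalCons (fun j => d j.succ) (y (finEquivUnits hK γ hγ i))
                (finEquivUnits hK γ hγ i) (a₀, a)) =
              Algebra.trace (ZMod p) L (a₀ * y (finEquivUnits hK γ hγ i)) +
                Algebra.trace (ZMod p) K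
                  (∑ j : Fin t, a j * ((γ ^ (d j.succ * (i : ℤ)) : Kˣ) : K)) := by
            simp only [LinearMap.toAddMonoidHom_coe, traceFunctionalCons, LinearMap.coprod_apply,
              LinearMap.mulRight_apply, map_add, traceFunctional_apply, Algebra.trace_trace, hξ]
          rw [h7]
          refine ⟨fun ⟨z, hz, hu⟩ => ?_, fun hu => ⟨_, h6, hu⟩⟩
          rw [hu, (algebraMap L K).injective (hz.trans h6.symm)]
        simp only [nihoCodeOne, Set.mem_ofPred_eq, h5, Prod.exists])
    refine ⟨h1, ?_, fun r hr => ?_⟩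
    · rw [← h2']
      ext j
      have h4 : (p : ℚ) = 2 := by exact_mod_cast h2
      congr 2
      rw [h4]
      ring
    · rw [← h3 r hr, powerSumCount]
      congr 3
      ext x
      have h4 := sum_smul_traceFunctionalCons_eq_zero_iff (fun j => d j.succ) hy Finset.univ
        (fun _ => (1 : L)) x
      simp only [one_smul, map_one, one_mul] at h4
      rw [h4]
      exact Fin.forall_fin_succ
  · obtain ⟨D, hDΔ, hDq, hdj⟩ := hd.exists_modEq heven ht1
    obtain ⟨v, c, g, H⟩ := exists_isScaledFamily_traceFunctional (L := L) hL hK hΔq hDΔ hDq hdj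
      (hle t ht)
    rw [← he] at H
    obtain ⟨h1, h2, h3⟩ := H.weightFrequency_eq (p := p) hL _ hτ (finEquivUnits hK γ hγ)
      (C := nihoCodeTwo p q K γ d) (fun u => by
        simp only [nihoCodeTwo, Set.mem_ofPred_eq, LinearMap.toAddMonoidHom_coe,
          traceFunctional_apply, Algebra.trace_trace, hξ])
    refine ⟨h1, h2, fun r hr => ?_⟩
    rw [← h3 r hr, powerSumCount]
    congr 3
    ext x
    have h4 := sum_smul_traceFunctional_eq_zero_iff d Finset.univ (fun _ => (1 : L)) x
    simp only [one_smul, map_one, one_mul] at h4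
    rw [h4]
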